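/- **Corollary 3.8.** Let $d,e\ge 1$ and $n\ge 2$ be integers with $de\ge 2$, and let $W=G(de,e,n)\subset GL_n(\mathbb C)$ be the group of all monomial $n\times n$ matrices (exactly one nonzero entry in each row and each column) whose nonzero entries are $(de)$-th roots of unity and for which the product of the nonzero entries is a $d$-th root of unity. Let $W$ act on $V=\mathbb C^n$ in the natural way, on $V^*$ by the dual action, and on the symmetric algebra $S=S(V^*)\cong\mathbb C[x_1,\dots,x_n]$, graded by polynomial degree, and on the exterior powers accordingly. For a representation $U$ of $W$ let $$\operatorname{Hilb}\big((S\otimes\wedge V^*\otimes U)^W;q,t\big)=\sum_{i\ge 0}\sum_{k=0}^{n}\dim\big((S^i(V^*)\otimes\wedge^kV^*\otimes U)^W\big)\,q^it^k ,$$ and for the character $\chi$ of a representation $M$ of $W$ let $P_W(\chi;q,t)=\operatorname{Hilb}((S\otimes\wedge V^*\otimes M^*)^W;q,t)$. Write $(z;q)_k=(1-z)(1-zq)\cdots(1-zq^{k-1})$, and write $(\chi_{\wedge^rV})^*$ for the character of $(\wedge^rV)^*$. Then for $0\le r\le n$ the series $$H_r:=\operatorname{Hilb}\big((S\otimes\wedge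 V^*\otimes\wedge^rV)^W;q,t\big)=P_W\big((\chi_{\wedge^rV})^*;q,t\big)$$ is given by the following formulas (as formal Laurent series in $q$ over $\mathbb Q(t)$). * For $r=0$: $$H_0=\frac{(-tq^{de-1};q^{de})_{n-1}\,(1+tq^{dn-1})}{(q^{de};q^{de})_{n-1}\,(1-q^{dn})}.$$ * For $1\le r\le n-1$ and $d\ge 2$: $$H_r=q^{de\binom r2+r}\,\frac{(-tq^{-1};q^{-de})_r\,(-tq^{de-1};q^{de})_{n-1-r}}{(q^{de};q^{de})_r\,(q^{de};q^{de})_{n-r}\,(1-q^{dn})}\Big(1-q^{den}+tq^{-1}\big(q^{de(n-r)}(1-q^{dn})+q^{dn}-q^{den}\big)\Big).$$ * For $1\le r\le n-1$ and $d=1$: $$\begin{aligned}H_r=q^{e\binom r2}\,\frac{(-tq^{-1};q^{-e})_{r-1}\,(-tq^{e-1};q^{e})_{n-1-r}}{(q^{e};q^{e})_r\,(q^{e};q^{e})_{n-r}\,(1-q^{n})}\Big(&q^r(1+tq^{(n-r)e-1})(1+tq^{-(r-1)e-1})(1-q^n)\\&+q^{(n-r)(e-1)-1}(1+tq^{e-1})(1-q^n)(q+t)\\&+q^{r-1}(1+tq^{-(r-1)e-1})(q+t)(q^n-q^{n(e-1)})\Big).\end{aligned}$$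 * For $r=n$: $$H_n=q^{de\binom{n-1}2+n-1}\,\frac{(-tq^{-1};q^{-de})_{n-1}}{(q^{de};q^{de})_{n-1}\,(1-q^{dn})}\cdot\begin{cases}q^{de(n-1)+1}+t&\text{if }d\ge 2,\\ q^{(n-1)(e-1)}+t&\text{if }d=1.\end{cases}$$ -/

import Mathlib

open scoped TensorProduct

namespace MonomialGroups

noncomputable section

/-- The monomial matrix sending the basis vector `y_j` to `a_j y_{σ(j)}`. -/
def monomialMatrix {n : ℕ} (σ : Equiv.Perm (Fin n)) (a : Fin n → ℂˣ) :
    Matrix (Fin n) (Fin n) ℂ :=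
  Matrix.of fun i j => if i = σ j then (a j : ℂ) else 0

theorem monomialMatrix_mul {n : ℕ} (σ τ : Equiv.Perm (Fin n)) (a b : Fin n → ℂˣ) :
    monomialMatrix σ a * monomialMatrix τ b
      = monomialMatrix (σ * τ) (fun j => a (τ j) * b j) := by
  ext i j
  simp [monomialMatrix, Matrix.mul_apply]
  rfl

theorem monomialMatrix_one {n : ℕ} :
    monomialMatrix (1 : Equiv.Perm (Fin n)) (fun _ => 1) = 1 := by
  ext i j
  simp [monomialMatrix, Matrix.one_apply]
  rfl

/-- The Shephard-Todd group `G(de,e,n)`: the `n × n` monomial matrices whose nonzero entries are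
`(de)`-th roots of unity and for which the product of the nonzero entries is a `d`-th root of
unity. -/
def shephardTodd (d e n : ℕ) : Subgroup (GL (Fin n) ℂ) where
  carrier := {g | ∃ (σ : Equiv.Perm (Fin n)) (a : Fin n → ℂˣ),
    (∀ j, a j ^ (d * e) = 1) ∧ (∏ j, a j) ^ d = 1 ∧
      (g : Matrix (Fin n) (Fin n) ℂ) = monomialMatrix σ a}
  one_mem' := ⟨1, fun _ => 1, by simp, by simp, by simp [monomialMatrix_one]⟩
  mul_mem' := by
    rintro g h ⟨σ, a, ha, ha', hg⟩ ⟨τ, b, hb, hb', hh⟩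
    refine ⟨σ * τ, fun j => a (τ j) * b j, fun j => ?_, ?_, ?_⟩
    · rw [mul_pow, ha, hb, one_mul]
    · rw [Finset.prod_mul_distrib, Equiv.prod_comp τ a, mul_pow, ha', hb', one_mul]
    · rw [Matrix.GeneralLinearGroup.coe_mul, hg, hh, monomialMatrix_mul]
  inv_mem' := by
    rintro g ⟨σ, a, ha, ha', hg⟩
    refine ⟨σ⁻¹, fun j => (a (σ⁻¹ j))⁻¹, fun j => ?_, ?_, ?_⟩
    · rw [inv_pow, ha, inv_one]
    · rw [Finset.prod_inv_distrib, Equiv.prod_comp σ⁻¹ a, inv_pow, ha', inv_one]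
    · rw [Matrix.coe_units_inv, hg]
      refine Matrix.inv_eq_left_inv ?_
      rw [monomialMatrix_mul, ← monomialMatrix_one]
      congr 1
      · simp
      · funext j
        simp

/-- The reflection representation `V = ℂ^n` of a subgroup `W` of `GL_n(ℂ)`, with `y_1, …, y_n` the
standard basis. -/
def reflectionRep {n : ℕ} (W : Subgroup (GL (Fin n) ℂ)) : Representation ℂ W (Fin n → ℂ) where
  toFun w := Matrix.mulVecLin ((w : GL (Fin n) ℂ) : Matrix (Fin n) (Fin n) ℂ)
  map_one' := by simp; rfl
  map_mul' w w' := by simp [Matrix.mulVecLin_mul]; rfl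

/-- The `k`-th exterior power of a representation. -/
def exteriorRep {G U : Type*} [Group G] [AddCommGroup U] [Module ℂ U]
    (ρ : Representation ℂ G U) (k : ℕ) : Representation ℂ G (⋀[ℂ]^k U) where
  toFun g := exteriorPower.map k (ρ g)
  map_one' := by
    rw [map_one]
    exact exteriorPower.map_id
  map_mul' g h := by
    rw [map_mul]
    exact exteriorPower.map_comp (ρ h) (ρ g)

/-- The action `(g · f)(v) = f(g⁻¹ v)` of `g ∈ GL_n(ℂ)` on `S(V^*) = ℂ[x_1, …, x_n]`, where
`x_1, …, x_n` is the basis of `V^*` dual to `y_1, …, y_n`: the contragredient linear substitution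
of the variables. -/
def polyAction {n : ℕ} (g : GL (Fin n) ℂ) :
    MvPolynomial (Fin n) ℂ →ₐ[ℂ] MvPolynomial (Fin n) ℂ :=
  MvPolynomial.aeval fun j =>
    ∑ k, MvPolynomial.C (((g⁻¹ : GL (Fin n) ℂ) : Matrix (Fin n) (Fin n) ℂ) j k) *
      MvPolynomial.X k

theorem polyAction_one {n : ℕ} : polyAction (1 : GL (Fin n) ℂ) = AlgHom.id ℂ _ := by
  ext1 j
  simp [polyAction, Matrix.one_apply]

theorem polyAction_mul {n : ℕ} (g h : GL (Fin n) ℂ) :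
    polyAction (g * h) = (polyAction g).comp (polyAction h) := by
  ext1 j
  simp only [polyAction, mul_inv_rev, AlgHom.comp_apply, MvPolynomial.aeval_X, map_sum, map_mul,
    MvPolynomial.aeval_C, MvPolynomial.algebraMap_eq, Matrix.GeneralLinearGroup.coe_mul,
    Matrix.mul_apply, Finset.sum_mul, Finset.mul_sum]
  rw [Finset.sum_comm]
  simp only [mul_assoc]

theorem polyAction_mem {n : ℕ} (g : GL (Fin n) ℂ) (i : ℕ) (f : MvPolynomial (Fin n) ℂ)
    (hf : f ∈ MvPolynomial.homogeneousSubmodule (Fin n) ℂ i) :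
    polyAction g f ∈ MvPolynomial.homogeneousSubmodule (Fin n) ℂ i := by
  have h := MvPolynomial.IsHomogeneous.aeval (n := 1) hf
    (fun j => ∑ k, MvPolynomial.C (((g⁻¹ : GL (Fin n) ℂ) : Matrix (Fin n) (Fin n) ℂ) j k) *
      MvPolynomial.X k) (fun j => MvPolynomial.IsHomogeneous.sum _ _ _
        fun k _ => MvPolynomial.isHomogeneous_C_mul_X _ k)
  rwa [one_mul] at h

/-- The representation of `W` on `S^i = S^i(V^*)`, the homogeneous polynomials of degree `i`. -/
def symRep {n : ℕ} (W : Subgroup (GL (Fin n) ℂ)) (i : ℕ) :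
    Representation ℂ W (MvPolynomial.homogeneousSubmodule (Fin n) ℂ i) where
  toFun w := (polyAction (w : GL (Fin n) ℂ)).toLinearMap.restrict (polyAction_mem _ i)
  map_one' := by
    ext1 f
    apply Subtype.ext
    simp [polyAction_one]
  map_mul' w w' := by
    ext1 f
    apply Subtype.ext
    simp [polyAction_mul]
    rfl

/-- The vector space `S^i(V^*) ⊗ ∧^k V^* ⊗ U`, for `V = ℂ^n`. -/
abbrev MixedSpace (n i k : ℕ) (U : Type*) [AddCommGroup U] [Module ℂ U] : Type _ :=
  MvPolynomial.homogeneousSubmodule (Fin n) ℂ i ⊗[ℂ]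
    (⋀[ℂ]^k (Module.Dual ℂ (Fin n → ℂ)) ⊗[ℂ] U)

/-- The representation of `W` on `S^i(V^*) ⊗ ∧^k V^* ⊗ U`, for a representation `τ` of `W`
on `U`. -/
def mixedRep {n : ℕ} (W : Subgroup (GL (Fin n) ℂ)) {U : Type*} [AddCommGroup U] [Module ℂ U]
    (τ : Representation ℂ W U) (i k : ℕ) : Representation ℂ W (MixedSpace n i k U) :=
  (symRep W i).tprod ((exteriorRep (reflectionRep W).dual k).tprod τ)

/-- The space `(S^i(V^*) ⊗ ∧^k V^* ⊗ U)^W`. -/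
def mixedInvariants {n : ℕ} (W : Subgroup (GL (Fin n) ℂ)) {U : Type*} [AddCommGroup U]
    [Module ℂ U] (τ : Representation ℂ W U) (i k : ℕ) : Submodule ℂ (MixedSpace n i k U) :=
  Representation.invariants (k := ℂ) (G := W) (V := MixedSpace n i k U) (mixedRep W τ i k)

/-- The Hilbert series of `(S(V^*) ⊗ ∧ V^* ⊗ U)^W` in `ℚ[t][[q]]`: the coefficient of `q^i t^k` is
the dimension of `(S^i(V^*) ⊗ ∧^k V^* ⊗ U)^W`, for `0 ≤ k ≤ n`. -/
def hilbertPowerSeries {n : ℕ} (W : Subgroup (GL (Fin n) ℂ)) {U : Type*} [AddCommGroup U]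
    [Module ℂ U] (τ : Representation ℂ W U) : PowerSeries (Polynomial ℚ) :=
  PowerSeries.mk fun i => ∑ k ∈ Finset.range (n + 1),
    Polynomial.monomial k (Module.finrank ℂ (mixedInvariants W τ i k) : ℚ)

/-- The field `ℚ(t)((q))` of formal Laurent series in `q` over `ℚ(t)`. -/
abbrev SeriesField : Type := LaurentSeries (RatFunc ℚ)

/-- The element `q` of `ℚ(t)((q))`. -/
def qVar : SeriesField := HahnSeries.single 1 1

/-- The element `t` of `ℚ(t)((q))`. -/
def tVar : SeriesField := HahnSeries.C RatFunc.X

/-- The inclusion of `ℚ[t][[q]]` in `ℚ(t)((q))`. -/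
def seriesEmbedding : PowerSeries (Polynomial ℚ) →+* SeriesField :=
  (HahnSeries.ofPowerSeries ℤ (RatFunc ℚ)).comp
    (PowerSeries.map (algebraMap (Polynomial ℚ) (RatFunc ℚ)))

/-- `Hilb((S(V^*) ⊗ ∧ V^* ⊗ U)^W; q, t)`, as an element of `ℚ(t)((q))`. -/
def Hilb {n : ℕ} (W : Subgroup (GL (Fin n) ℂ)) {U : Type*} [AddCommGroup U] [Module ℂ U]
    (τ : Representation ℂ W U) : SeriesField :=
  seriesEmbedding (hilbertPowerSeries W τ)

/-- `P_W(χ; q, t) = Hilb((S(V^*) ⊗ ∧ V^* ⊗ M^*)^W; q, t)`, where `χ` is the character of the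
representation `τ` of `W` on `M`. -/
def isotypicSeries {n : ℕ} (W : Subgroup (GL (Fin n) ℂ)) {M : Type*} [AddCommGroup M]
    [Module ℂ M] (τ : Representation ℂ W M) : SeriesField :=
  Hilb W τ.dual

/-- The representation of `W` on `∧^r V`. -/
def wedgeRep {n : ℕ} (W : Subgroup (GL (Fin n) ℂ)) (r : ℕ) :
    Representation ℂ W (⋀[ℂ]^r (Fin n → ℂ)) :=
  exteriorRep (reflectionRep W) r

/-- The `q`-Pochhammer symbol `(z; p)_k = (1 - z)(1 - zp) ⋯ (1 - zp^(k-1))`. -/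
def qPochhammer {K : Type*} [CommRing K] (z p : K) (k : ℕ) : K :=
  ∏ i ∈ Finset.range k, (1 - z * p ^ i)

end

end MonomialGroups

/-! The monomials $x^m\otimes dx_I\otimes y_J$ form a basis of
$S^i(V^*)\otimes\wedge^kV^*\otimes\wedge^rV$ that a monomial matrix permutes up to scalars. For such
an action the dimension of the invariants is the number of orbits whose stabilizers act by the
trivial scalar (`finrank_invariants_of_monomial`).

Attach to each coordinate $j$ the label $(m_j,\varepsilon_j,\delta_j)$, with $\varepsilon,\delta$
the indicators of $I$ and $J$. All permutation matrices lie in $W$, so orbits are multisets of $n$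
labels. Diagonal matrices act through the charges $m+\varepsilon-\delta$, and they act trivially
exactly when all charges are congruent modulo $N=de$ to one multiple $ds$ with $0\le s<e$.
Permutations act by the product of the signs on $I$ and $J$, so a label with $\varepsilon\ne\delta$
(a fermion) must not be repeated, while one with $\varepsilon=\delta$ (a boson) may be. This is
`finrank_mixedInvariants`.

For fixed $s$, the $n-r$ labels with $\delta=0$ and the $r$ labels with $\delta=1$ are chosen
independently. Each family consists of one bosonic and one fermionic progression with exponent step
$N$, so the $q$-binomial theorem (`tsum_weight`) sums it to a product. Hence $H_r$, times two
$q$-Pochhammer symbols, is a sum of $e$ explicit products (`hilbertPowerSeries_wedgeRep`).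

With $c=ds$, the least fermionic exponents are $c-1$ for $\delta=0$ and $c+1$ for $\delta=1$,
reduced modulo $N$. The first wraps around only at $c=0$. The second wraps only at $c=N-1$, which is
a multiple of $d$ only if $d=1$; this is the origin of the case distinction. The other terms form a
geometric series in $q^{dn}$ (`sum_chargeTerm_of_two_le`, `sum_chargeTerm_of_one`), and algebra
gives the stated formulas. -/

namespace MonomialGroups

noncomputable section

/-! ### Invariants of monomial representations -/

/-- If a finite group acts monomially on a basis, the dimension of the invariants is the number
of orbits on which the stabilizer characters are trivial. -/
theorem finrank_invariants_of_monomial {G V X Y : Type*} [Group G] [Finite G] [AddCommGroup V]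
    [Module ℂ V] [Finite X] (ρ : Representation ℂ G V) (b : Module.Basis X ℂ V)
    (act : G → X → X) (χ : G → X → ℂ)
    (hmon : ∀ g x, ρ g (b x) = χ g x • b (act g x)) (π : X → Y) (good : Y → Prop)
    (hπ : ∀ g x, π (act g x) = π x) (htrans : ∀ x y, π x = π y → ∃ g, act g x = y)
    (hgood : ∀ g x, good (π x) → act g x = x → χ g x = 1)
    (hbad : ∀ x, ¬ good (π x) → ∃ g, act g x = x ∧ χ g x ≠ 1) :
    Module.finrank ℂ ρ.invariants = Nat.card {y // good y ∧ y ∈ Set.range π} := by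
  classical
  have := Fintype.ofFinite G
  have := Fintype.ofFinite X
  have hinj : ∀ g, Function.Injective (ρ g) := fun g v w h => by
    simpa [← Module.End.mul_apply, ← map_mul] using congrArg (ρ g⁻¹) h
  have hχ : ∀ g x, χ g x ≠ 0 := fun g x h => by
    have h1 := hmon g x
    rw [h, zero_smul] at h1
    exact b.ne_zero x (hinj g (by rw [h1, map_zero]))
  -- `act` is not assumed to be a group action. If two indices had the same image under `act g`,
  -- then `ρ g` would identify multiples of two distinct basis vectors.
  have hact : ∀ g, Function.Injective (act g) := fun g x y h => by
    by_contra hxy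
    have h1 : χ g y • b x = χ g x • b y := hinj g (by
      rw [map_smul, map_smul, hmon, hmon, h, smul_smul, smul_smul, mul_comm])
    have h2 := congrArg (fun v => b.repr v x) h1
    simp [Ne.symm hxy] at h2
    exact hχ g y h2
  have hcoef : ∀ g x v, b.repr (ρ g v) (act g x) = χ g x * b.repr v x := by
    intro g x v
    conv_lhs => rw [← b.sum_repr v]
    simp only [map_sum, map_smul, hmon, Finsupp.coe_finsetSum, Finset.sum_apply,
      Finsupp.smul_apply, Module.Basis.repr_self, smul_eq_mul]
    rw [Finset.sum_eq_single x]
    · simp [mul_comm]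
    · intro z _ hz
      rw [Finsupp.single_eq_of_ne (fun h => hz (hact g h.symm))]
      simp
    · simp
  have hfix : ∀ (v : ρ.invariants) g, ρ g (v : V) = v := fun v g => v.2 g
  let Y' := {y // good y ∧ y ∈ Set.range π}
  choose rep hrep using fun y : Y' => y.2.2
  have : Finite Y' := Finite.of_injective rep fun y z h => Subtype.ext (by
    rw [← hrep y, ← hrep z, h])
  have := Fintype.ofFinite Y'
  let Φ : ρ.invariants →ₗ[ℂ] (Y' → ℂ) :=
    LinearMap.pi fun y => (b.coord (rep y)).comp ρ.invariants.subtype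
  have hΦ : ∀ v y, Φ v y = b.repr (v : V) (rep y) := fun v y => rfl
  have hΦi : Function.Injective Φ := by
    rw [injective_iff_map_eq_zero]
    intro v hv
    refine Subtype.ext (b.ext_elem fun x => ?_)
    simp only [ZeroMemClass.coe_zero, map_zero, Finsupp.coe_zero, Pi.zero_apply]
    -- A coefficient on a good orbit is a multiple of the one at the representative. On a bad orbit,
    -- a stabilizing element with scalar different from 1 forces it to vanish.
    by_cases hx : good (π x)
    · obtain ⟨g, hg⟩ := htrans (rep ⟨π x, hx, x, rfl⟩) x (hrep _)
      have h1 := hcoef g (rep ⟨π x, hx, x, rfl⟩) v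
      rw [hfix, hg, ← hΦ, hv] at h1
      simpa using h1
    · obtain ⟨g, hg, hc⟩ := hbad x hx
      have h1 := hcoef g x v
      rw [hfix, hg] at h1
      by_contra h0
      exact hc (mul_right_cancel₀ h0 (by rw [← h1, one_mul]))
  have hΦs : Function.Surjective Φ := by
    rw [← LinearMap.range_eq_top, eq_top_iff, ← (Pi.basisFun ℂ Y').span_eq, Submodule.span_le]
    rintro _ ⟨y, rfl⟩
    -- The average over the group, up to scaling: its coefficient at `rep y` is the number of
    -- elements fixing `rep y`, because each of them acts there by 1.
    let w : V := ∑ g, ρ g (b (rep y))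
    have hw : w ∈ ρ.invariants := fun h => by
      simp only [w, map_sum, ← Module.End.mul_apply, ← map_mul]
      exact Fintype.sum_equiv (Equiv.mulLeft h) _ _ fun g => rfl
    have hwz : ∀ z, b.repr w (rep z) = if z = y then
        ((Finset.univ.filter fun g => act g (rep y) = rep y).card : ℂ) else 0 := by
      intro z
      simp only [w, map_sum, hmon, map_smul, Finsupp.coe_finsetSum, Finset.sum_apply,
        Finsupp.smul_apply, Module.Basis.repr_self, smul_eq_mul, Finsupp.single_apply]
      split_ifs with hzy
      · subst hzy
        rw [Finset.card_filter, Nat.cast_sum]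
        refine Finset.sum_congr rfl fun g _ => ?_
        split_ifs with hg
        · rw [hgood g _ (by rw [hrep]; exact z.2.1) hg]; simp
        · simp
      · refine Finset.sum_eq_zero fun g _ => ?_
        rw [if_neg, mul_zero]
        intro hg
        refine hzy (Subtype.ext ?_)
        rw [← hrep z, ← hg, hπ, hrep]
    have hne : ((Finset.univ.filter fun g => act g (rep y) = rep y).card : ℂ) ≠ 0 := by
      obtain ⟨g, hg⟩ := htrans (rep y) (rep y) rfl
      exact Nat.cast_ne_zero.2 (Finset.card_ne_zero_of_mem (a := g) (by simp [hg]))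
    refine ⟨(((Finset.univ.filter fun g => act g (rep y) = rep y).card : ℂ)⁻¹) • ⟨w, hw⟩, ?_⟩
    ext z
    rw [map_smul, Pi.smul_apply, hΦ, hwz, Pi.basisFun_apply, Pi.single_apply, smul_eq_mul]
    split_ifs
    · exact inv_mul_cancel₀ hne
    · exact mul_zero _
  rw [(LinearEquiv.ofBijective Φ ⟨hΦi, hΦs⟩).finrank_eq, Module.finrank_fintype_fun_eq_card,
    Nat.card_eq_fintype_card]

/-! ### Signs of permutations on exterior powers -/

section

open Set (powersetCard)

/-- The permutation of `Fin k` induced by a bijection `σ : I → J` of `k`-element sets, both being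
listed in increasing order. -/
def orderPerm {α : Type*} [LinearOrder α] {k : ℕ} (σ : Equiv.Perm α) (I J : powersetCard α k)
    (h : ∀ a, a ∈ I.val ↔ σ a ∈ J.val) : Equiv.Perm (Fin k) :=
  ((Set.powersetCard.orderIsoOfFin I).toEquiv.trans (σ.subtypeEquiv h)).trans (Set.powersetCard.orderIsoOfFin J).toEquiv.symm

/-- Listing the set in increasing order only conjugates the restricted permutation. Extending the
restriction by the identity to the whole type makes signs on sets of different sizes comparable. -/
theorem sign_orderPerm_self {α : Type*} [LinearOrder α] [Fintype α] {k : ℕ} (σ : Equiv.Perm α)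
    (I : powersetCard α k) (h : ∀ a, a ∈ I.val ↔ σ a ∈ I.val) :
    Equiv.Perm.sign (orderPerm σ I I h)
      = Equiv.Perm.sign (Equiv.Perm.ofSubtype (σ.subtypePerm (p := (· ∈ I.val))
          fun a => (h a).symm)) := by
  rw [Equiv.Perm.sign_ofSubtype]
  exact Equiv.Perm.sign_symm_trans_trans (σ.subtypePerm (p := (· ∈ I.val)) fun a => (h a).symm)
    (Set.powersetCard.orderIsoOfFin I).toEquiv.symm

/-- A permutation stabilizing two sets, and fixing every point that lies in only one of them, acts
on both of them with the same sign. -/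
theorem sign_orderPerm_eq {α : Type*} [LinearOrder α] [Fintype α] {k r : ℕ} (σ : Equiv.Perm α)
    (I : powersetCard α k) (J : powersetCard α r) (hI : ∀ a, a ∈ I.val ↔ σ a ∈ I.val)
    (hJ : ∀ a, a ∈ J.val ↔ σ a ∈ J.val)
    (h : ∀ a, ¬ (a ∈ I.val ↔ a ∈ J.val) → σ a = a) :
    Equiv.Perm.sign (orderPerm σ I I hI) = Equiv.Perm.sign (orderPerm σ J J hJ) := by
  have key : ∀ (K : Finset α) (hK : ∀ a, σ a ∈ K ↔ a ∈ K) (a : α),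
      Equiv.Perm.ofSubtype (σ.subtypePerm (p := (· ∈ K)) hK) a = if a ∈ K then σ a else a := by
    intro K hK a
    split_ifs with ha
    · rw [Equiv.Perm.ofSubtype_apply_of_mem (p := (· ∈ K)) _ ha]; rfl
    · rw [Equiv.Perm.ofSubtype_apply_of_not_mem (p := (· ∈ K)) _ ha]
  rw [sign_orderPerm_self, sign_orderPerm_self]
  congr 1
  ext a
  rw [key, key]
  by_cases hab : a ∈ I.val ↔ a ∈ J.val
  · simp only [hab]
  · rw [h a hab, ite_self, ite_self]

theorem sign_orderPerm_swap {α : Type*} [LinearOrder α] [Fintype α] {k : ℕ} {i j : α}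
    (hij : i ≠ j) (I : powersetCard α k) (h : ∀ a, a ∈ I.val ↔ Equiv.swap i j a ∈ I.val)
    (hi : i ∈ I.val) :
    Equiv.Perm.sign (orderPerm (Equiv.swap i j) I I h) = -1 := by
  rw [sign_orderPerm_self, Equiv.Perm.ofSubtype_subtypePerm, Equiv.Perm.sign_swap hij]
  intro a ha
  have hj : j ∈ I.val := by simpa using (h i).1 hi
  rcases Equiv.eq_or_eq_of_swap_apply_ne_self ha with rfl | rfl <;> assumption

theorem sign_orderPerm_of_fixes {α : Type*} [LinearOrder α] [Fintype α] {k : ℕ}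
    (σ : Equiv.Perm α) (I : powersetCard α k) (h : ∀ a, a ∈ I.val ↔ σ a ∈ I.val)
    (hf : ∀ a ∈ I.val, σ a = a) :
    Equiv.Perm.sign (orderPerm σ I I h) = 1 := by
  have : orderPerm σ I I h = 1 := by
    ext1 l
    rw [orderPerm, Equiv.trans_apply, Equiv.symm_apply_eq]
    exact Subtype.ext (hf _ (Set.powersetCard.orderIsoOfFin I l).2)
  rw [this, map_one]

theorem orderEmb_orderPerm {α : Type*} [LinearOrder α] {k : ℕ} (σ : Equiv.Perm α)
    (I J : powersetCard α k) (h : ∀ a, a ∈ I.val ↔ σ a ∈ J.val) (l : Fin k) :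
    Set.powersetCard.ofFinEmbEquiv.symm J (orderPerm σ I J h l)
      = σ (Set.powersetCard.ofFinEmbEquiv.symm I l) := by
  have : ((Set.powersetCard.orderIsoOfFin J) (orderPerm σ I J h l) : α) = σ ((Set.powersetCard.orderIsoOfFin I) l) := by
    simp [orderPerm]
  exact this

/-- Multilinearity extracts the scalars, and alternation sorts the images into increasing order at
the cost of a sign. -/
theorem exteriorPower_map_basis {α U : Type*} [LinearOrder α] [AddCommGroup U] [Module ℂ U]
    (u : Module.Basis α ℂ U) (L : U →ₗ[ℂ] U) (σ : Equiv.Perm α) (c : α → ℂ)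
    (hL : ∀ j, L (u j) = c j • u (σ j)) {k : ℕ} (I J : powersetCard α k)
    (h : ∀ a, a ∈ I.val ↔ σ a ∈ J.val) :
    exteriorPower.map k L (u.exteriorPower k I)
      = ((∏ i ∈ I.val, c i) * ((Equiv.Perm.sign (orderPerm σ I J h) : ℤ) : ℂ)) •
        u.exteriorPower k J := by
  rw [exteriorPower.basis_apply, exteriorPower.basis_apply,
    exteriorPower.map_apply_ιMulti_family, exteriorPower.ιMulti_family,
    exteriorPower.ιMulti_family]
  have h1 : (L ∘ u) ∘ (Set.powersetCard.ofFinEmbEquiv.symm I)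
      = fun l => c (Set.powersetCard.ofFinEmbEquiv.symm I l) •
        ((u ∘ Set.powersetCard.ofFinEmbEquiv.symm J) ∘ orderPerm σ I J h) l := by
    funext l
    simp only [Function.comp_apply, hL, orderEmb_orderPerm]
  rw [h1, AlternatingMap.map_smul_univ, AlternatingMap.map_perm, mul_smul]
  have h2 : ∏ l, c (Set.powersetCard.ofFinEmbEquiv.symm I l) = ∏ i ∈ I.val, c i := by
    rw [← Finset.prod_coe_sort I.val]
    exact Fintype.prod_equiv (Set.powersetCard.orderIsoOfFin I).toEquiv _ _ fun l => rfl
  rw [h2]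
  rcases Int.units_eq_one_or (Equiv.Perm.sign (orderPerm σ I J h)) with hs | hs <;> simp [hs]

end

/-! ### Monomial matrices on vectors, covectors and polynomials -/

section

open Set (powersetCard)

theorem coe_inv_of_monomialMatrix {n : ℕ} {g : GL (Fin n) ℂ} {σ : Equiv.Perm (Fin n)}
    {a : Fin n → ℂˣ} (h : (g : Matrix (Fin n) (Fin n) ℂ) = monomialMatrix σ a) :
    ((g⁻¹ : GL (Fin n) ℂ) : Matrix (Fin n) (Fin n) ℂ)
      = monomialMatrix σ⁻¹ fun j => (a (σ⁻¹ j))⁻¹ := by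
  rw [Matrix.coe_units_inv, h]
  refine Matrix.inv_eq_left_inv ?_
  rw [monomialMatrix_mul, ← monomialMatrix_one]
  congr 1
  · simp
  · funext j
    simp

theorem reflectionRep_basisFun {n : ℕ} {W : Subgroup (GL (Fin n) ℂ)} (w : W)
    {σ : Equiv.Perm (Fin n)} {a : Fin n → ℂˣ}
    (h : ((w : GL (Fin n) ℂ) : Matrix (Fin n) (Fin n) ℂ) = monomialMatrix σ a) (j : Fin n) :
    reflectionRep W w (Pi.basisFun ℂ (Fin n) j)
      = (a j : ℂ) • Pi.basisFun ℂ (Fin n) (σ j) := by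
  change Matrix.mulVecLin ((w : GL (Fin n) ℂ) : Matrix (Fin n) (Fin n) ℂ) _ = _
  ext i
  rw [h, Pi.basisFun_apply, Matrix.mulVecLin_apply, Matrix.mulVec_single_one]
  simp [monomialMatrix, Pi.single_apply]

theorem dual_reflectionRep_dualBasis {n : ℕ} {W : Subgroup (GL (Fin n) ℂ)} (w : W)
    {σ : Equiv.Perm (Fin n)} {a : Fin n → ℂˣ}
    (h : ((w : GL (Fin n) ℂ) : Matrix (Fin n) (Fin n) ℂ) = monomialMatrix σ a) (j : Fin n) :
    (reflectionRep W).dual w ((Pi.basisFun ℂ (Fin n)).dualBasis j)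
      = ((a j)⁻¹ : ℂ) • (Pi.basisFun ℂ (Fin n)).dualBasis (σ j) := by
  have hi : (((w⁻¹ : W) : GL (Fin n) ℂ) : Matrix (Fin n) (Fin n) ℂ)
      = monomialMatrix σ⁻¹ fun j => (a (σ⁻¹ j))⁻¹ := coe_inv_of_monomialMatrix h
  refine (Pi.basisFun ℂ (Fin n)).ext fun l => ?_
  rw [Representation.dual_apply, Module.Dual.transpose_apply, LinearMap.comp_apply,
    reflectionRep_basisFun _ hi]
  simp only [map_smul, LinearMap.smul_apply, Module.Basis.dualBasis_apply_self, smul_eq_mul]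
  by_cases hl : l = σ j
  · subst hl; simp
  · rw [if_neg, if_neg hl]
    · simp
    · intro h'; exact hl (by rw [← h']; simp)

theorem polyAction_X {n : ℕ} {g : GL (Fin n) ℂ} {σ : Equiv.Perm (Fin n)} {a : Fin n → ℂˣ}
    (h : (g : Matrix (Fin n) (Fin n) ℂ) = monomialMatrix σ a) (j : Fin n) :
    polyAction g (MvPolynomial.X j)
      = MvPolynomial.C ((a j)⁻¹ : ℂ) * MvPolynomial.X (σ j) := by
  rw [polyAction, MvPolynomial.aeval_X, coe_inv_of_monomialMatrix h, Finset.sum_eq_single (σ j)]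
  · simp [monomialMatrix]
  · intro l _ hl
    have : j ≠ σ⁻¹ l := fun h' => hl (by rw [h']; simp)
    simp only [monomialMatrix, Matrix.of_apply, if_neg this, map_zero, zero_mul]
  · simp

theorem polyAction_monomial {n : ℕ} {g : GL (Fin n) ℂ} {σ : Equiv.Perm (Fin n)}
    {a : Fin n → ℂˣ} (h : (g : Matrix (Fin n) (Fin n) ℂ) = monomialMatrix σ a)
    (m : Fin n →₀ ℕ) :
    polyAction g (MvPolynomial.monomial m 1)
      = (∏ j, ((a j : ℂ)⁻¹) ^ m j) • MvPolynomial.monomial (m.equivMapDomain σ) 1 := by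
  rw [MvPolynomial.monomial_eq, MvPolynomial.monomial_eq, map_mul, MvPolynomial.C_1, map_one,
    one_mul, one_mul, Finsupp.prod_fintype _ _ (fun _ => pow_zero _),
    Finsupp.prod_fintype _ _ (fun _ => pow_zero _), map_prod, MvPolynomial.smul_eq_C_mul,
    map_prod]
  simp only [map_pow, polyAction_X h, mul_pow, Finset.prod_mul_distrib]
  congr 1
  exact Fintype.prod_equiv σ _ _ fun j => by simp [Finsupp.equivMapDomain_apply]

/-- The monomials of degree `i` as a basis of the homogeneous polynomials of degree `i`. -/
def homogeneousBasis (n i : ℕ) : Module.Basis {m : Fin n →₀ ℕ | m.degree = i} ℂ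
    (MvPolynomial.homogeneousSubmodule (Fin n) ℂ i) :=
  (MvPolynomial.basisRestrictSupport ℂ {m : Fin n →₀ ℕ | m.degree = i}).map
    (LinearEquiv.ofEq _ _ (MvPolynomial.homogeneousSubmodule_eq_finsupp_supported _ _ i).symm)

theorem coe_homogeneousBasis {n i : ℕ} (m : {m : Fin n →₀ ℕ | m.degree = i}) :
    (homogeneousBasis n i m : MvPolynomial (Fin n) ℂ) = MvPolynomial.monomial m.1 1 := by
  have : ∀ m, (MvPolynomial.basisRestrictSupport ℂ {m : Fin n →₀ ℕ | m.degree = i} m :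
      MvPolynomial (Fin n) ℂ) = MvPolynomial.monomial m.1 1 := by
    intro m
    have h : MvPolynomial.monomial m.1 (1 : ℂ) ∈
        MvPolynomial.restrictSupport ℂ {m : Fin n →₀ ℕ | m.degree = i} :=
      (MvPolynomial.monomial_mem_restrictSupport ℂ).2 (Or.inl m.2)
    have h1 : (MvPolynomial.basisRestrictSupport ℂ {m : Fin n →₀ ℕ | m.degree = i}).repr
        ⟨MvPolynomial.monomial m.1 1, h⟩ = Finsupp.single m 1 := by
      ext m'
      change MvPolynomial.coeff m'.1 (MvPolynomial.monomial m.1 (1 : ℂ)) = _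
      rw [MvPolynomial.coeff_monomial, Finsupp.single_apply]
      simp only [Subtype.ext_iff]
    rw [← Module.Basis.repr_symm_single_one, ← h1, LinearEquiv.symm_apply_apply]
  rw [homogeneousBasis, Module.Basis.map_apply]
  exact this m

end

/-! ### The monomial basis and its labels -/

section

open Set (powersetCard)

/-- The indices of the monomial basis of `S^i(V^*) ⊗ ∧^k V^* ⊗ ∧^r V`. -/
abbrev MixedIndex (n i k r : ℕ) : Type :=
  {m : Fin n →₀ ℕ | m.degree = i} × (powersetCard (Fin n) k × powersetCard (Fin n) r)

/-- The monomial basis of `S^i(V^*) ⊗ ∧^k V^* ⊗ ∧^r V`. -/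
def mixedBasis (n i k r : ℕ) :
    Module.Basis (MixedIndex n i k r) ℂ (MixedSpace n i k (⋀[ℂ]^r (Fin n → ℂ))) :=
  (homogeneousBasis n i).tensorProduct
    (((Pi.basisFun ℂ (Fin n)).dualBasis.exteriorPower k).tensorProduct
      ((Pi.basisFun ℂ (Fin n)).exteriorPower r))

/-- The image of a set of cardinality `k` under a permutation. -/
def permuteSet {n k : ℕ} (σ : Equiv.Perm (Fin n)) (I : powersetCard (Fin n) k) :
    powersetCard (Fin n) k :=
  ⟨I.val.map σ.toEmbedding, (Finset.card_map _).trans I.2⟩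

theorem apply_mem_permuteSet {n k : ℕ} (σ : Equiv.Perm (Fin n)) (I : powersetCard (Fin n) k)
    (j : Fin n) : j ∈ I.val ↔ σ j ∈ (permuteSet σ I).val := by
  simp [permuteSet]

/-- The permutation action on the indices of the monomial basis. -/
def permuteIndex {n i k r : ℕ} (σ : Equiv.Perm (Fin n)) (x : MixedIndex n i k r) :
    MixedIndex n i k r :=
  (⟨x.1.1.equivMapDomain σ, by
    have h := x.1.2
    simp only [Set.mem_ofPred_eq, Finsupp.degree_eq_sum] at h ⊢
    refine Eq.trans ?_ h
    rw [← Equiv.sum_comp σ]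
    simp [Finsupp.equivMapDomain_apply]⟩, permuteSet σ x.2.1, permuteSet σ x.2.2)

/-- The coefficient by which the monomial matrix with permutation `σ` and entries `a` acts on the
monomial basis of `S^i(V^*) ⊗ ∧^k V^* ⊗ ∧^r V`. -/
def mixedCoeff {n i k r : ℕ} (σ : Equiv.Perm (Fin n)) (a : Fin n → ℂˣ) (x : MixedIndex n i k r) :
    ℂ :=
  (∏ j, ((a j : ℂ)⁻¹) ^ x.1.1 j) *
    (((∏ j ∈ x.2.1.val, (a j : ℂ)⁻¹) *
        ((Equiv.Perm.sign (orderPerm σ x.2.1 _ (apply_mem_permuteSet σ x.2.1)) : ℤ) : ℂ)) *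
      ((∏ j ∈ x.2.2.val, (a j : ℂ)) *
        ((Equiv.Perm.sign (orderPerm σ x.2.2 _ (apply_mem_permuteSet σ x.2.2)) : ℤ) : ℂ)))

theorem mixedRep_mixedBasis {n i k r : ℕ} {W : Subgroup (GL (Fin n) ℂ)} (w : W)
    {σ : Equiv.Perm (Fin n)} {a : Fin n → ℂˣ}
    (h : ((w : GL (Fin n) ℂ) : Matrix (Fin n) (Fin n) ℂ) = monomialMatrix σ a)
    (x : MixedIndex n i k r) :
    mixedRep W (wedgeRep W r) i k w (mixedBasis n i k r x)
      = mixedCoeff σ a x • mixedBasis n i k r (permuteIndex σ x) := by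
  obtain ⟨m, I, J⟩ := x
  have h1 : symRep W i w (homogeneousBasis n i m)
      = (∏ j, ((a j : ℂ)⁻¹) ^ m.1 j) •
        homogeneousBasis n i (permuteIndex σ ((m, I, J) : MixedIndex n i k r)).1 := by
    apply Subtype.ext
    change polyAction (w : GL (Fin n) ℂ) (homogeneousBasis n i m : MvPolynomial (Fin n) ℂ) = _
    rw [Submodule.coe_smul, coe_homogeneousBasis, coe_homogeneousBasis, polyAction_monomial h]
    rfl
  have h2 := exteriorPower_map_basis (Pi.basisFun ℂ (Fin n)).dualBasis _ σ _
    (dual_reflectionRep_dualBasis w h) I _ (apply_mem_permuteSet σ I)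
  have h3 := exteriorPower_map_basis (Pi.basisFun ℂ (Fin n)) _ σ _
    (reflectionRep_basisFun w h) J _ (apply_mem_permuteSet σ J)
  simp only [mixedBasis, Module.Basis.tensorProduct_apply']
  change (symRep W i w (homogeneousBasis n i m)) ⊗ₜ[ℂ]
    ((exteriorPower.map k ((reflectionRep W).dual w) _) ⊗ₜ[ℂ]
      (exteriorPower.map r (reflectionRep W w) _)) = _
  rw [h1, h2, h3, TensorProduct.smul_tmul_smul, TensorProduct.smul_tmul_smul]
  rfl

/-- The exponent and the two membership indicators attached to each coordinate by an index of
the monomial basis. -/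
def label {n i k r : ℕ} (x : MixedIndex n i k r) (j : Fin n) : ℕ × Bool × Bool :=
  (x.1.1 j, decide (j ∈ x.2.1.val), decide (j ∈ x.2.2.val))

theorem label_injective {n i k r : ℕ} :
    Function.Injective (label : MixedIndex n i k r → Fin n → ℕ × Bool × Bool) := by
  rintro ⟨m, I, J⟩ ⟨m', I', J'⟩ h
  simp only [label, funext_iff, Prod.mk.injEq, decide_eq_decide] at h
  refine Prod.ext (Subtype.ext (Finsupp.ext fun j => (h j).1)) (Prod.ext ?_ ?_)
  · exact Subtype.ext (Finset.ext fun j => (h j).2.1)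
  · exact Subtype.ext (Finset.ext fun j => (h j).2.2)

theorem label_permuteIndex {n i k r : ℕ} (σ : Equiv.Perm (Fin n)) (x : MixedIndex n i k r)
    (j : Fin n) : label (permuteIndex σ x) (σ j) = label x j := by
  simp [label, permuteIndex, Finsupp.equivMapDomain_apply, ← apply_mem_permuteSet]

theorem permuteIndex_eq_iff {n i k r : ℕ} (σ : Equiv.Perm (Fin n)) (x y : MixedIndex n i k r) :
    permuteIndex σ x = y ↔ ∀ j, label y (σ j) = label x j := by
  constructor
  · rintro rfl j
    exact label_permuteIndex σ x j
  · intro h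
    refine label_injective (funext fun j => ?_)
    obtain ⟨j, rfl⟩ := σ.surjective j
    rw [h, label_permuteIndex]

/-- Every function is a label, for suitable degrees. -/
theorem exists_label_eq {n : ℕ} (f : Fin n → ℕ × Bool × Bool) :
    ∃ x : MixedIndex n (∑ j, (f j).1) (∑ j, (f j).2.1.toNat) (∑ j, (f j).2.2.toNat),
      label x = f := by
  have hc : ∀ p : Fin n → Bool, (Finset.univ.filter fun j => p j = true).card
      = ∑ j, (p j).toNat := by
    intro p
    rw [Finset.card_filter]
    refine Finset.sum_congr rfl fun j _ => ?_
    cases p j <;> rfl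
  refine ⟨(⟨Finsupp.equivFunOnFinite.symm fun j => (f j).1, ?_⟩, ⟨_, hc fun j => (f j).2.1⟩,
    ⟨_, hc fun j => (f j).2.2⟩), ?_⟩
  · simp [Finsupp.degree_eq_sum]
  · funext j
    simp [label]

theorem sum_label {n i k r : ℕ} (x : MixedIndex n i k r) :
    ∑ j, (label x j).1 = i ∧ ∑ j, (label x j).2.1.toNat = k ∧
      ∑ j, (label x j).2.2.toNat = r := by
  obtain ⟨m, I, J⟩ := x
  have hc : ∀ s : Finset (Fin n), ∑ j, (decide (j ∈ s)).toNat = s.card := by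
    intro s
    simp [Bool.toNat, Bool.cond_decide, Finset.sum_ite_mem]
  refine ⟨?_, (hc I.val).trans I.2, (hc J.val).trans J.2⟩
  have := m.2
  rwa [Set.mem_ofPred_eq, Finsupp.degree_eq_sum] at this

end

/-! ### Admissible multisets and trivial stabilizer characters -/

section

open Set (powersetCard)

/-- The weight of a label under a diagonal matrix: the monomial `x^m dx^ε y^δ` has charge
`m + ε - δ`. -/
def charge (l : ℕ × Bool × Bool) : ℤ := l.1 + l.2.1.toNat - l.2.2.toNat

/-- The multisets of labels that index the invariants of `G(de,e,n)`. -/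
def IsAdmissible (d e : ℕ) (M : Multiset (ℕ × Bool × Bool)) : Prop :=
  (∀ l, l.2.1 ≠ l.2.2 → M.count l ≤ 1) ∧
    ∃ s < e, ∀ l ∈ M, ((d * e : ℕ) : ℤ) ∣ charge l - d * s

/-- The multiset of labels of an index. -/
def labels {n i k r : ℕ} (x : MixedIndex n i k r) : Multiset (ℕ × Bool × Bool) :=
  Finset.univ.val.map (label x)

/-- Equal multisets of values mean fibers of equal size; bijections between the fibers glue to a
permutation. -/
theorem exists_perm_of_map_univ_eq {α β : Type*} [Fintype α] {f g : α → β}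
    (h : Finset.univ.val.map f = Finset.univ.val.map g) :
    ∃ σ : Equiv.Perm α, ∀ j, g (σ j) = f j := by
  classical
  have hc : ∀ c, Fintype.card {a // f a = c} = Fintype.card {a // g a = c} := by
    intro c
    have h1 := congrArg (Multiset.count c) h
    rw [Multiset.count_map, Multiset.count_map] at h1
    rw [Fintype.card_subtype, Fintype.card_subtype]
    simp only [eq_comm (a := c)] at h1
    exact h1
  exact ⟨Equiv.ofFiberEquiv fun c => Fintype.equivOfCardEq (hc c), fun j =>
    Equiv.ofFiberEquiv_map _ j⟩

theorem labels_permuteIndex {n i k r : ℕ} (σ : Equiv.Perm (Fin n)) (x : MixedIndex n i k r) :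
    labels (permuteIndex σ x) = labels x := by
  have h : label x = label (permuteIndex σ x) ∘ σ :=
    funext fun j => (label_permuteIndex σ x j).symm
  rw [labels, labels, h, ← Multiset.map_map]
  congr 1
  exact (congrArg Finset.val (Finset.map_univ_equiv σ)).symm

/-- On the stabilizer of an index, the scalar separates into a diagonal character, governed by the
charges, and the signs of the permutation on the two subsets. -/
theorem mixedCoeff_of_fixes {n i k r : ℕ} {σ : Equiv.Perm (Fin n)} (a : Fin n → ℂˣ)
    {x : MixedIndex n i k r} (h : permuteIndex σ x = x) :
    ∃ (hI : ∀ j, j ∈ x.2.1.val ↔ σ j ∈ x.2.1.val) (hJ : ∀ j, j ∈ x.2.2.val ↔ σ j ∈ x.2.2.val),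
      mixedCoeff σ a x = ((∏ j, a j ^ (-charge (label x j)) : ℂˣ) : ℂ) *
        (((Equiv.Perm.sign (orderPerm σ x.2.1 x.2.1 hI) *
          Equiv.Perm.sign (orderPerm σ x.2.2 x.2.2 hJ) : ℤˣ) : ℤ) : ℂ) := by
  -- The image set equals the original only propositionally, and `orderPerm` depends on it;
  -- abstracting the image permits substitution.
  have hs : ∀ {p : ℕ} (I K : powersetCard (Fin n) p) (hK : ∀ j, j ∈ I.val ↔ σ j ∈ K.val),
      K = I → ∃ hI : ∀ j, j ∈ I.val ↔ σ j ∈ I.val,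
        Equiv.Perm.sign (orderPerm σ I K hK) = Equiv.Perm.sign (orderPerm σ I I hI) := by
    rintro p I K hK rfl
    exact ⟨hK, rfl⟩
  obtain ⟨hI, hI'⟩ := hs x.2.1 _ (apply_mem_permuteSet σ x.2.1) (congrArg (fun y => y.2.1) h)
  obtain ⟨hJ, hJ'⟩ := hs x.2.2 _ (apply_mem_permuteSet σ x.2.2) (congrArg (fun y => y.2.2) h)
  refine ⟨hI, hJ, ?_⟩
  have hd : ((∏ j, a j ^ (-charge (label x j)) : ℂˣ) : ℂ)
      = (∏ j, ((a j : ℂ)⁻¹) ^ x.1.1 j) * ((∏ j ∈ x.2.1.val, (a j : ℂ)⁻¹) *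
        (∏ j ∈ x.2.2.val, (a j : ℂ))) := by
    have hp : ∀ (s : Finset (Fin n)) (f : Fin n → ℂ),
        ∏ j ∈ s, f j = ∏ j, if j ∈ s then f j else 1 := fun s f => by simp [Finset.prod_ite_mem]
    rw [hp x.2.1.val, hp x.2.2.val,
      ← Finset.prod_mul_distrib, ← Finset.prod_mul_distrib, Units.coe_prod]
    refine Finset.prod_congr rfl fun j _ => ?_
    have ha := (a j).ne_zero
    have he : -charge (label x j) = -(x.1.1 j : ℤ) + (-(decide (j ∈ x.2.1.val)).toNat
        + (decide (j ∈ x.2.2.val)).toNat) := by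
      simp only [charge, label]; ring
    rw [he, Units.val_zpow_eq_zpow_val, zpow_add₀ ha, zpow_add₀ ha, zpow_neg, zpow_neg,
      zpow_natCast, zpow_natCast, zpow_natCast, inv_pow]
    split_ifs with h1 h2 h2 <;> simp [h1, h2]
  rw [hd, mixedCoeff, hI', hJ']
  push_cast
  ring

/-- The common residue $ds$ of the charges turns the diagonal part into a power of $(\prod
a_j)^d=1$. The two signs agree because the permutation fixes every coordinate with a fermionic
label. -/
theorem mixedCoeff_eq_one {d e n i k r : ℕ} {σ : Equiv.Perm (Fin n)} {a : Fin n → ℂˣ}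
    (ha : ∀ j, a j ^ (d * e) = 1) (ha' : (∏ j, a j) ^ d = 1) {x : MixedIndex n i k r}
    (h : permuteIndex σ x = x) (hx : IsAdmissible d e (labels x)) :
    mixedCoeff σ a x = 1 := by
  classical
  obtain ⟨hI, hJ, hc⟩ := mixedCoeff_of_fixes a h
  obtain ⟨hodd, s, -, hs⟩ := hx
  have h1 : ∏ j, a j ^ (-charge (label x j)) = 1 := by
    have : ∀ j, a j ^ (-charge (label x j)) = a j ^ (-((d : ℤ) * s)) := by
      intro j
      obtain ⟨c, hc⟩ := hs (label x j) (Multiset.mem_map_of_mem _ (Finset.mem_univ_val j))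
      have h2 : -charge (label x j) = -((d : ℤ) * s) + ((d * e : ℕ) : ℤ) * -c := by linarith
      rw [h2, zpow_add, zpow_mul _ ((d * e : ℕ) : ℤ), zpow_natCast, ha, one_zpow, mul_one]
    rw [Finset.prod_congr rfl fun j _ => this j, Finset.prod_zpow, zpow_neg, zpow_mul,
      zpow_natCast _ d, ha', one_zpow, inv_one]
  have h2 : Equiv.Perm.sign (orderPerm σ x.2.1 x.2.1 hI)
      = Equiv.Perm.sign (orderPerm σ x.2.2 x.2.2 hJ) := by
    refine sign_orderPerm_eq σ x.2.1 x.2.2 hI hJ fun j hj => ?_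
    by_contra hne
    -- The coordinates `j` and `σ j` carry the same label, which is fermionic and so occurs only
    -- once.
    have h3 := hodd (label x j) (by simpa [label] using hj)
    rw [labels, Multiset.count_map] at h3
    refine hne ((Finset.card_le_one (s := Finset.univ.filter fun a => label x j = label x a)).1
      h3 (σ j) ?_ j ?_)
    · simp [(permuteIndex_eq_iff σ x x).1 h j]
    · simp
  rw [hc, h1, h2, Int.units_mul_self]
  simp

end

/-! ### Obstructed orbits and the dimension count -/

section

open Set (powersetCard)

/-- A repeated fermion is detected by the transposition of its two coordinates, which gives $-1$.
Otherwise the charges are at fault, and diagonal matrices detect it. -/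
theorem exists_mixedCoeff_ne_one {d e n i k r : ℕ} (hd : 1 ≤ d) (he : 1 ≤ e) (hn : 1 ≤ n)
    {x : MixedIndex n i k r} (hx : ¬ IsAdmissible d e (labels x)) :
    ∃ (σ : Equiv.Perm (Fin n)) (a : Fin n → ℂˣ), (∀ j, a j ^ (d * e) = 1) ∧
      (∏ j, a j) ^ d = 1 ∧ permuteIndex σ x = x ∧ mixedCoeff σ a x ≠ 1 := by
  classical
  rw [IsAdmissible, not_and_or] at hx
  rcases hx with hx | hx
  · push Not at hx
    obtain ⟨l, hl, hc⟩ := hx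
    rw [labels, Multiset.count_map] at hc
    obtain ⟨p, hp, q, hq, hpq⟩ :=
      (Finset.one_lt_card (s := Finset.univ.filter fun a => l = label x a)).1 hc
    simp only [Finset.mem_filter, Finset.mem_univ, true_and] at hp hq
    have hfix : permuteIndex (Equiv.swap p q) x = x := by
      rw [permuteIndex_eq_iff]
      intro j
      by_cases h1 : j = p
      · rw [h1, Equiv.swap_apply_left, ← hp, ← hq]
      by_cases h2 : j = q
      · rw [h2, Equiv.swap_apply_right, ← hp, ← hq]
      rw [Equiv.swap_apply_of_ne_of_ne h1 h2]
    refine ⟨Equiv.swap p q, fun _ => 1, by simp, by simp, hfix, ?_⟩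
    obtain ⟨hI, hJ, h⟩ := mixedCoeff_of_fixes (fun _ => 1) hfix
    have hfx : ∀ {c : ℕ} (K : powersetCard (Fin n) c), p ∉ K.val → q ∉ K.val →
        ∀ a ∈ K.val, Equiv.swap p q a = a := fun K h1 h2 a ha =>
      Equiv.swap_apply_of_ne_of_ne (fun h => h1 (h ▸ ha)) (fun h => h2 (h ▸ ha))
    have hp' : l = (x.1.1 p, decide (p ∈ x.2.1.val), decide (p ∈ x.2.2.val)) := hp
    have hq' : l = (x.1.1 q, decide (q ∈ x.2.1.val), decide (q ∈ x.2.2.val)) := hq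
    have hqI : q ∈ x.2.1.val ↔ p ∈ x.2.1.val := by
      have := congrArg (fun y => y.2.1) (hp'.symm.trans hq')
      simpa using this.symm
    have hqJ : q ∈ x.2.2.val ↔ p ∈ x.2.2.val := by
      have := congrArg (fun y => y.2.2) (hp'.symm.trans hq')
      simpa using this.symm
    -- A fermionic label puts both transposed points in exactly one of the two sets, so exactly one
    -- of the two signs is $-1$.
    by_cases hpI : p ∈ x.2.1.val
    · have hpJ : p ∉ x.2.2.val := fun h => hl (by simp [hp', hpI, h])
      rw [h, sign_orderPerm_swap hpq _ hI hpI,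
        sign_orderPerm_of_fixes _ _ hJ (hfx _ hpJ (by rwa [hqJ]))]
      norm_num
    · have hpJ : p ∈ x.2.2.val := by
        by_contra h
        exact hl (by simp [hp', hpI, h])
      rw [h, sign_orderPerm_swap hpq _ hJ hpJ,
        sign_orderPerm_of_fixes _ _ hI (hfx _ hpI (by rwa [hqI]))]
      norm_num
  · by_contra hcon
    have hfix : permuteIndex 1 x = x := by simp [permuteIndex_eq_iff]
    have key : ∀ a : Fin n → ℂˣ, (∀ j, a j ^ (d * e) = 1) → (∏ j, a j) ^ d = 1 →
        ∏ j, a j ^ (charge (label x j)) = 1 := by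
      intro a ha ha'
      have h1 : mixedCoeff 1 a x = 1 := by
        by_contra h
        exact hcon ⟨1, a, ha, ha', hfix, h⟩
      obtain ⟨hI, hJ, h⟩ := mixedCoeff_of_fixes a hfix
      rw [h1, sign_orderPerm_of_fixes _ _ hI (fun _ _ => rfl),
        sign_orderPerm_of_fixes _ _ hJ (fun _ _ => rfl)] at h
      simp only [mul_one, Units.val_one, Int.cast_one] at h
      have h2 : ∏ j, a j ^ (-charge (label x j)) = 1 := Units.ext h.symm
      simpa [Finset.prod_inv_distrib] using h2
    -- Two kinds of diagonal test matrices suffice. Entries $\zeta,\zeta^{-1}$ in two places show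
    -- that all charges agree modulo $de$; a single entry $\zeta^e$ shows that $d$ divides the
    -- charge.
    obtain ⟨ζ, hζ⟩ : ∃ ζ : ℂˣ, IsPrimitiveRoot ζ (d * e) := by
      have h := Complex.isPrimitiveRoot_exp (d * e) (Nat.mul_pos hd he).ne'
      exact ⟨(h.isUnit (Nat.mul_pos hd he).ne').unit, IsPrimitiveRoot.coe_units_iff.1 h⟩
    have hprod : ∀ (p : Fin n) (z : ℂˣ),
        ∏ j, (Pi.mulSingle p z : Fin n → ℂˣ) j ^ (charge (label x j))
          = z ^ charge (label x p) := by
      intro p z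
      rw [Finset.prod_eq_single p]
      · simp
      · intro j _ hj
        simp [Pi.mulSingle_eq_of_ne hj]
      · simp
    have hroot : ∀ (p : Fin n) (z : ℂˣ), z ^ (d * e) = 1 →
        ∀ j, (Pi.mulSingle p z : Fin n → ℂˣ) j ^ (d * e) = 1 := by
      intro p z hz j
      by_cases hj : j = p
      · subst hj; simpa using hz
      · simp [Pi.mulSingle_eq_of_ne hj]
    have h1 : ∀ p q, ((d * e : ℕ) : ℤ) ∣ charge (label x p) - charge (label x q) := by
      intro p q
      have h := key (Pi.mulSingle p ζ * Pi.mulSingle q ζ⁻¹)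
        (fun j => by
          rw [Pi.mul_apply, mul_pow, hroot p ζ hζ.pow_eq_one, hroot q ζ⁻¹ (by
            rw [inv_pow, hζ.pow_eq_one, inv_one]), one_mul])
        (by simp [Finset.prod_mul_distrib])
      simp only [Pi.mul_apply, mul_zpow, Finset.prod_mul_distrib, hprod] at h
      rw [← hζ.zpow_eq_one_iff_dvd, zpow_sub, ← inv_zpow]
      exact h
    let p₀ : Fin n := ⟨0, hn⟩
    have h2 : (d : ℤ) ∣ charge (label x p₀) := by
      have h := key (Pi.mulSingle p₀ (ζ ^ e))
        (hroot p₀ _ (by rw [← pow_mul, mul_comm, pow_mul, hζ.pow_eq_one, one_pow]))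
        (by simp [← pow_mul, mul_comm e d, hζ.pow_eq_one])
      rw [hprod, ← zpow_natCast, ← zpow_mul, hζ.zpow_eq_one_iff_dvd] at h
      push_cast at h
      rw [mul_comm] at h
      exact Int.dvd_of_mul_dvd_mul_left (by omega) h
    obtain ⟨u, hu⟩ := h2
    have he' : (e : ℤ) ≠ 0 := by omega
    -- The charge $du$ matters only modulo $de$, so $u$ may be reduced modulo $e$.
    refine hx ⟨(u % e).toNat, ?_, ?_⟩
    · have := Int.emod_lt_of_pos u (by omega : (0 : ℤ) < e)
      have := Int.emod_nonneg u he'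
      omega
    · intro l hl
      obtain ⟨j, -, rfl⟩ := Multiset.mem_map.1 hl
      rw [Int.toNat_of_nonneg (Int.emod_nonneg u he')]
      have h3 : charge (label x j) - d * (u % e)
          = (charge (label x j) - charge (label x p₀)) + ((d * e : ℕ) : ℤ) * (u / e) := by
        have := Int.emod_add_mul_ediv u e
        push_cast
        rw [hu]
        linear_combination -(d : ℤ) * this
      rw [h3]
      exact dvd_add (h1 _ _) (dvd_mul_right _ _)

instance finite_shephardTodd {d e n : ℕ} [NeZero (d * e)] : Finite (shephardTodd d e n) := by
  let f : Equiv.Perm (Fin n) × (Fin n → rootsOfUnity (d * e) ℂ) → Matrix (Fin n) (Fin n) ℂ :=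
    fun p => monomialMatrix p.1 fun j => p.2 j
  refine Set.Finite.to_subtype (Set.Finite.of_finite_image (f := Units.val)
    ((Set.finite_range f).subset ?_) Units.val_injective.injOn)
  rintro _ ⟨g, ⟨σ, a, ha, -, hg⟩, rfl⟩
  exact ⟨(σ, fun j => ⟨a j, (mem_rootsOfUnity _ _).2 (ha j)⟩), hg.symm⟩

/-- Identifies the permutation and entries chosen for a group element with those from which it was
built. -/
theorem monomialMatrix_injective {n : ℕ} {σ τ : Equiv.Perm (Fin n)} {a b : Fin n → ℂˣ}
    (h : monomialMatrix σ a = monomialMatrix τ b) : σ = τ ∧ a = b := by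
  have h1 : ∀ j, (a j : ℂ) = if σ j = τ j then (b j : ℂ) else 0 := fun j => by
    simpa [monomialMatrix] using congrFun (congrFun h (σ j)) j
  have h2 : ∀ j, σ j = τ j := fun j => by
    by_contra hj
    exact (a j).ne_zero (by rw [h1, if_neg hj])
  exact ⟨Equiv.ext h2, funext fun j => Units.ext (by rw [h1, if_pos (h2 j)])⟩

theorem exists_shephardTodd_coe_eq {d e n : ℕ} (σ : Equiv.Perm (Fin n)) (a : Fin n → ℂˣ)
    (ha : ∀ j, a j ^ (d * e) = 1) (ha' : (∏ j, a j) ^ d = 1) :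
    ∃ w : shephardTodd d e n,
      ((w : GL (Fin n) ℂ) : Matrix (Fin n) (Fin n) ℂ) = monomialMatrix σ a := by
  refine ⟨⟨⟨monomialMatrix σ a, monomialMatrix σ⁻¹ fun j => (a (σ⁻¹ j))⁻¹, ?_, ?_⟩,
    σ, a, ha, ha', rfl⟩, rfl⟩
  all_goals
    rw [monomialMatrix_mul, ← monomialMatrix_one]
    congr 1
    · simp
    · funext j
      simp

/-- The dimension of `(S^i(V^*) ⊗ ∧^k V^* ⊗ ∧^r V)^W` for `W = G(de,e,n)` as the number of
admissible multisets of labels of the corresponding degrees. -/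
theorem finrank_mixedInvariants {d e n : ℕ} (hd : 1 ≤ d) (he : 1 ≤ e) (hn : 1 ≤ n) (i k r : ℕ) :
    Module.finrank ℂ (mixedInvariants (shephardTodd d e n) (wedgeRep (shephardTodd d e n) r) i k)
      = Nat.card {M : Multiset (ℕ × Bool × Bool) // IsAdmissible d e M ∧ M.card = n ∧
          (M.map fun l => l.1).sum = i ∧ (M.map fun l => l.2.1.toNat).sum = k ∧
          (M.map fun l => l.2.2.toNat).sum = r} := by
  classical
  have : NeZero (d * e) := ⟨(Nat.mul_pos hd he).ne'⟩
  have : Finite {m : Fin n →₀ ℕ | m.degree = i} :=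
    have := Module.Finite.iff_fg.2 (MvPolynomial.homogeneousSubmodule_fg (Fin n) ℂ i)
    Module.Finite.finite_basis (homogeneousBasis n i)
  choose σ a ha ha' hw using fun w : shephardTodd d e n => w.2
  have hmon := fun (w : shephardTodd d e n) (x : MixedIndex n i k r) =>
    mixedRep_mixedBasis w (hw w) x
  have h := finrank_invariants_of_monomial (G := shephardTodd d e n)
    (V := MixedSpace n i k (⋀[ℂ]^r (Fin n → ℂ)))
    (mixedRep (shephardTodd d e n) (wedgeRep (shephardTodd d e n) r) i k) (mixedBasis n i k r)
    (fun w => permuteIndex (σ w)) (fun w => mixedCoeff (σ w) (a w))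
    hmon labels (IsAdmissible d e)
    (fun w x => labels_permuteIndex _ x) ?_
    (fun w x hx hfix => mixedCoeff_eq_one (ha w) (ha' w) hfix hx) ?_
  · refine h.trans (Nat.card_congr (Equiv.subtypeEquivRight fun M => and_congr_right fun _ => ?_))
    constructor
    · rintro ⟨x, rfl⟩
      obtain ⟨h1, h2, h3⟩ := sum_label x
      simp only [labels, Multiset.card_map, Multiset.map_map]
      exact ⟨by simp, h1, h2, h3⟩
    · rintro ⟨h0, h1, h2, h3⟩
      obtain ⟨f, rfl⟩ : ∃ f : Fin n → ℕ × Bool × Bool, Finset.univ.val.map f = M := by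
        induction M using Quotient.inductionOn with | _ l => ?_
        subst h0
        refine ⟨l.get, (Fin.univ_val_map _).trans ?_⟩
        simp
      simp only [Multiset.map_map] at h1 h2 h3
      subst h1 h2 h3
      obtain ⟨x, hx⟩ := exists_label_eq f
      exact ⟨x, congrArg (Multiset.map · Finset.univ.val) hx⟩
  -- Permutation matrices belong to the group, so two indices with the same multiset of labels lie
  -- in one orbit.
  · intro x y hxy
    obtain ⟨τ, hτ⟩ := exists_perm_of_map_univ_eq hxy
    obtain ⟨w, h⟩ := exists_shephardTodd_coe_eq (d := d) (e := e) τ (fun _ => 1) (by simp)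
      (by simp)
    exact ⟨w, by rwa [(monomialMatrix_injective ((hw w).symm.trans h)).1, permuteIndex_eq_iff]⟩
  · intro x hx
    obtain ⟨τ, b, hb, hb', hfix, hne⟩ := exists_mixedCoeff_ne_one hd he hn hx
    obtain ⟨w, h⟩ := exists_shephardTodd_coe_eq τ b hb hb'
    obtain ⟨h1, h2⟩ := monomialMatrix_injective ((hw w).symm.trans h)
    exact ⟨w, by rwa [h1], by rwa [h1, h2]⟩

end

/-! ### The $q$-binomial theorem for multisets -/

section

open scoped PowerSeries PowerSeries.WithPiTopology

/-- The multisets of size `n` of elements `(k, false)` and `(k, true)`, for `k : ℕ`, in which no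
`(k, true)` is repeated. -/
def SuperMultiset (n : ℕ) : Type :=
  {s : Multiset (ℕ × Bool) // s.card = n ∧ ∀ k, s.count (k, true) ≤ 1}

/-- The weight of an element: `A Q^k` for `(k, false)` and `B Q^k` for `(k, true)`. -/
def elementWeight {R : Type*} [CommRing R] (A B Q : R) (l : ℕ × Bool) : R :=
  (if l.2 then B else A) * Q ^ l.1

/-- The product of the weights of the elements of a multiset. -/
def SuperMultiset.weight {R : Type*} [CommRing R] (A B Q : R) {n : ℕ} (s : SuperMultiset n) : R :=
  (s.1.map (elementWeight A B Q)).prod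

/-- The shift `k ↦ k + 1`. -/
def shift (s : Multiset (ℕ × Bool)) : Multiset (ℕ × Bool) :=
  s.map (Prod.map Nat.succ id)

theorem shift_injective : Function.Injective shift :=
  Multiset.map_injective (Prod.map_injective.2 ⟨Nat.succ_injective, Function.injective_id⟩)

theorem zero_notMem_shift (s : Multiset (ℕ × Bool)) (c : Bool) : (0, c) ∉ shift s := by
  simp [shift]

theorem count_succ_shift (s : Multiset (ℕ × Bool)) (k : ℕ) (c : Bool) :
    (shift s).count (k + 1, c) = s.count (k, c) :=
  Multiset.count_map_eq_count' _ s
    (Prod.map_injective.2 ⟨Nat.succ_injective, Function.injective_id⟩) (k, c)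

theorem exists_shift_eq {s : Multiset (ℕ × Bool)} (h : ∀ c, (0, c) ∉ s) : ∃ t, shift t = s := by
  refine ⟨s.map (Prod.map Nat.pred id), ?_⟩
  rw [shift, Multiset.map_map]
  refine (Multiset.map_congr rfl fun l hl => ?_).trans s.map_id
  obtain ⟨_ | k, c⟩ := l
  · exact absurd hl (h c)
  · rfl

theorem count_shift_le_one {s : Multiset (ℕ × Bool)} :
    (∀ k, (shift s).count (k, true) ≤ 1) ↔ ∀ k, s.count (k, true) ≤ 1 := by
  constructor
  · intro h k
    rw [← count_succ_shift]
    exact h _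
  · rintro h (_ | k)
    · rw [Multiset.count_eq_zero_of_notMem (zero_notMem_shift s true)]
      exact zero_le_one
    · rw [count_succ_shift]
      exact h k

/-- Removing the elements `(0, false)` and `(0, true)`: a multiset of size `n + 1` is a shifted
one, or contains `(0, false)`, or is a shifted one of size `n` with `(0, true)` added. -/
def SuperMultiset.join {n : ℕ} :
    SuperMultiset (n + 1) ⊕ (SuperMultiset n ⊕ SuperMultiset n) → SuperMultiset (n + 1)
  | .inl s => ⟨shift s.1, by rw [shift, Multiset.card_map, s.2.1], count_shift_le_one.2 s.2.2⟩
  | .inr (.inl s) => ⟨(0, false) ::ₘ s.1, by rw [Multiset.card_cons, s.2.1], fun k => by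
      rw [Multiset.count_cons_of_ne (by simp)]; exact s.2.2 k⟩
  | .inr (.inr s) => ⟨(0, true) ::ₘ shift s.1, by
      rw [Multiset.card_cons, shift, Multiset.card_map, s.2.1], by
      rintro (_ | k)
      · rw [Multiset.count_cons_self, Multiset.count_eq_zero_of_notMem (zero_notMem_shift _ _)]
      · rw [Multiset.count_cons_of_ne (by simp)]
        exact count_shift_le_one.2 s.2.2 _⟩

/-- The three cases are read off from the elements with first entry 0. Since `(0, false)` may be
repeated, removing one copy leaves the rest unrestricted. Since `(0, true)` may not, removing it in
the absence of `(0, false)` leaves a shifted multiset. -/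
theorem SuperMultiset.join_bijective (n : ℕ) :
    Function.Bijective (SuperMultiset.join (n := n)) := by
  constructor
  · have h0 := zero_notMem_shift
    rintro (s | s | s) (s' | s' | s') h <;> replace h := congrArg Subtype.val h <;>
      simp only [SuperMultiset.join] at h
    · rw [Subtype.ext (shift_injective h)]
    · exact absurd (h ▸ Multiset.mem_cons_self _ _) (h0 s.1 false)
    · exact absurd (h ▸ Multiset.mem_cons_self _ _) (h0 s.1 true)
    · exact absurd (h ▸ Multiset.mem_cons_self _ _) (h0 s'.1 false)
    · rw [Subtype.ext ((Multiset.cons_inj_right _).1 h)]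
    · have : (0, false) ∈ (0, true) ::ₘ shift s'.1 := h ▸ Multiset.mem_cons_self _ _
      simp [h0] at this
    · exact absurd (h ▸ Multiset.mem_cons_self _ _) (h0 s'.1 true)
    · have : (0, false) ∈ (0, true) ::ₘ shift s.1 := h ▸ Multiset.mem_cons_self _ _
      simp [h0] at this
    · rw [Subtype.ext (shift_injective ((Multiset.cons_inj_right _).1 h))]
  · rintro ⟨s, hs, hc⟩
    by_cases h1 : (0, false) ∈ s
    · obtain ⟨t, rfl⟩ := Multiset.exists_cons_of_mem h1
      refine ⟨.inr (.inl ⟨t, by simpa using hs, fun k => ?_⟩), rfl⟩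
      have := hc k
      rwa [Multiset.count_cons_of_ne (by simp)] at this
    · by_cases h2 : (0, true) ∈ s
      · obtain ⟨t, rfl⟩ := Multiset.exists_cons_of_mem h2
        have h3 := hc 0
        rw [Multiset.count_cons_self] at h3
        have h4 : (0, true) ∉ t := Multiset.count_eq_zero.1 (by omega)
        obtain ⟨u, rfl⟩ := exists_shift_eq (s := t) (by
          rintro (_ | _)
          · exact fun h => h1 (Multiset.mem_cons_of_mem h)
          · exact h4)
        refine ⟨.inr (.inr ⟨u, by simpa [shift] using hs, count_shift_le_one.1 fun k => ?_⟩), rfl⟩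
        exact (Multiset.count_le_count_cons _ _ _).trans (hc k)
      · obtain ⟨u, rfl⟩ := exists_shift_eq (s := s) (by rintro (_ | _) <;> assumption)
        exact ⟨.inl ⟨u, by simpa [shift] using hs, count_shift_le_one.1 hc⟩, rfl⟩

theorem prod_map_elementWeight_shift {R : Type*} [CommRing R] (A B Q : R)
    (s : Multiset (ℕ × Bool)) :
    ((shift s).map (elementWeight A B Q)).prod
      = Q ^ s.card * (s.map (elementWeight A B Q)).prod := by
  rw [shift, Multiset.map_map, ← Multiset.prod_replicate, ← Multiset.map_const',
    ← Multiset.prod_map_mul]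
  congr 1
  refine Multiset.map_congr rfl fun l _ => ?_
  simp only [Function.comp_apply, elementWeight, Prod.map_fst, Prod.map_snd, id, pow_succ]
  ring

/-- Ensures that only multisets with bounded sum of first entries contribute to a given coefficient,
whatever the weights `A` and `B`. -/
theorem X_pow_dvd_prod_elementWeight {R : Type*} [CommRing R] (A B Q : R⟦X⟧)
    (hQ : PowerSeries.X ∣ Q) (s : Multiset (ℕ × Bool)) :
    (PowerSeries.X : R⟦X⟧) ^ (s.map Prod.fst).sum ∣ (s.map (elementWeight A B Q)).prod := by
  induction s using Multiset.induction with
  | empty => simp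
  | cons l s ih =>
    simp only [Multiset.map_cons, Multiset.sum_cons, Multiset.prod_cons, pow_add]
    exact mul_dvd_mul (Dvd.dvd.mul_left (pow_dvd_pow_of_dvd hQ _) _) ih

theorem finite_superMultiset_le (n i : ℕ) :
    {s : SuperMultiset n | (s.1.map Prod.fst).sum ≤ i}.Finite := by
  have : Finite (Sym (Fin (i + 1) × Bool) n) := inferInstance
  let f : Sym (Fin (i + 1) × Bool) n → Multiset (ℕ × Bool) := fun u =>
    u.1.map (Prod.map Fin.val id)
  refine Set.Finite.of_finite_image (f := Subtype.val) ((Set.finite_range f).subset ?_)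
    Subtype.val_injective.injOn
  rintro _ ⟨s, hs, rfl⟩
  -- Every first entry is at most the sum, hence at most `i`, so reduction modulo `i + 1` changes
  -- nothing.
  refine ⟨⟨s.1.map fun l => (Fin.ofNat (i + 1) l.1, l.2), by rw [Multiset.card_map, s.2.1]⟩, ?_⟩
  simp only [f, Multiset.map_map]
  refine (Multiset.map_congr rfl fun l hl => ?_).trans s.1.map_id
  have h1 : l.1 ≤ (s.1.map Prod.fst).sum := Multiset.le_sum_of_mem (Multiset.mem_map_of_mem _ hl)
  have h2 : (s.1.map Prod.fst).sum ≤ i := hs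
  refine Prod.ext ?_ rfl
  simpa using (by omega : l.1 < i + 1)

theorem finite_coeff_weight_ne_zero {R : Type*} [CommRing R] (A B Q : R⟦X⟧) (hQ : PowerSeries.X ∣ Q) (n i : ℕ) :
    {s : SuperMultiset n | PowerSeries.coeff i (s.weight A B Q) ≠ 0}.Finite := by
  refine (finite_superMultiset_le n i).subset fun s hs => ?_
  by_contra h
  exact hs (PowerSeries.X_pow_dvd_iff.1 (X_pow_dvd_prod_elementWeight A B Q hQ s.1) i
    (not_le.1 h))

theorem hasSum_of_eq {ι M : Type*} [AddCommMonoid M] [TopologicalSpace M] {f g : ι → M} {a : M}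
    (h : HasSum g a) (hfg : ∀ s, f s = g s) : HasSum f a :=
  (funext hfg : f = g) ▸ h

section Topology

variable {R : Type*} [CommRing R] [TopologicalSpace R]

theorem summable_of_finite_coeff_ne_zero {ι : Type*} {f : ι → R⟦X⟧}
    (h : ∀ i, {s | PowerSeries.coeff i (f s) ≠ 0}.Finite) : Summable f :=
  (PowerSeries.WithPiTopology.summable_iff_summable_coeff R).2 fun i =>
    summable_of_hasFiniteSupport (h i)

theorem summable_weight (A B Q : R⟦X⟧) (hQ : PowerSeries.X ∣ Q) (n : ℕ) :
    Summable fun s : SuperMultiset n => s.weight A B Q :=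
  summable_of_finite_coeff_ne_zero (finite_coeff_weight_ne_zero A B Q hQ n)

variable [DiscreteTopology R]

/-- Summing over the three pieces of `SuperMultiset.join`: a shift multiplies the weight by $Q$ to
the size, a new `(0, false)` by $A$, and a new `(0, true)` on a shifted multiset by $BQ^n$. -/
theorem tsum_weight_succ (A B Q : R⟦X⟧) (hQ : PowerSeries.X ∣ Q) (n : ℕ) :
    (1 - Q ^ (n + 1)) * ∑' s : SuperMultiset (n + 1), s.weight A B Q
      = (A + B * Q ^ n) * ∑' s : SuperMultiset n, s.weight A B Q := by
  have h1 := (summable_weight A B Q hQ (n + 1)).hasSum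
  have h0 := (summable_weight A B Q hQ n).hasSum
  have h2 := (Equiv.ofBijective _ (SuperMultiset.join_bijective n)).hasSum_iff.2 h1
  have h3 : HasSum ((fun s : SuperMultiset (n + 1) => s.weight A B Q) ∘
      (Equiv.ofBijective _ (SuperMultiset.join_bijective n)))
      (Q ^ (n + 1) * (∑' s : SuperMultiset (n + 1), s.weight A B Q) +
        (A * (∑' s : SuperMultiset n, s.weight A B Q)
          + B * Q ^ n * ∑' s : SuperMultiset n, s.weight A B Q)) := by
    refine HasSum.sum ?_ (HasSum.sum ?_ ?_)
    · refine hasSum_of_eq (h1.mul_left (Q ^ (n + 1))) fun s => ?_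
      refine (prod_map_elementWeight_shift A B Q s.1).trans ?_
      rw [s.2.1]; rfl
    · refine hasSum_of_eq (h0.mul_left A) fun s => ?_
      simp [SuperMultiset.join, SuperMultiset.weight, elementWeight]
    · refine hasSum_of_eq (h0.mul_left (B * Q ^ n)) fun s => ?_
      simp only [Function.comp_apply, Equiv.ofBijective_apply, SuperMultiset.join,
        SuperMultiset.weight, Multiset.map_cons, Multiset.prod_cons,
        prod_map_elementWeight_shift, s.2.1]
      simp [elementWeight, mul_assoc]
  have h4 := h2.unique h3
  linear_combination h4

/-- The `q`-binomial theorem: the generating function of multisets of size `n` of elements of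
weights `A, AQ, AQ², …` and of `B, BQ, BQ², …`, the latter without repetition. -/
theorem tsum_weight (A B Q : R⟦X⟧) (hQ : PowerSeries.X ∣ Q) (n : ℕ) :
    (∏ i ∈ Finset.range n, (1 - Q ^ (i + 1))) * ∑' s : SuperMultiset n, s.weight A B Q
      = ∏ i ∈ Finset.range n, (A + B * Q ^ i) := by
  induction n with
  | zero =>
    have : ∀ s : SuperMultiset 0, s.weight A B Q = 1 := fun s => by
      rw [SuperMultiset.weight, Multiset.card_eq_zero.1 s.2.1]; simp
    let s₀ : SuperMultiset 0 := ⟨0, rfl, by simp⟩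
    have hs : ∀ s, s = s₀ := fun s => Subtype.ext (Multiset.card_eq_zero.1 s.2.1)
    rw [tsum_eq_single s₀ fun s h => absurd (hs s) h, this]
    simp
  | succ n ih =>
    rw [Finset.prod_range_succ, Finset.prod_range_succ, mul_assoc, tsum_weight_succ A B Q hQ,
      ← ih]
    ring

end Topology

end

/-! ### Labels of a fixed charge as two progressions -/

section

/-- The least exponent `m` for which the label `(m, ε, δ)` has charge congruent to `c` modulo
`N`. -/
def leastExponent (N c : ℕ) (ε δ : Bool) : ℕ := (c + N + δ.toNat - ε.toNat) % N

/-- The labels with last entry `δ` and charge congruent to `c` modulo `N`: those with the sign of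
a fermion are the images of the `(k, true)`. -/
def toLabel (N c : ℕ) (δ : Bool) (l : ℕ × Bool) : ℕ × Bool × Bool :=
  (leastExponent N c (xor δ l.2) δ + N * l.1, xor δ l.2, δ)

/-- The inverse of `toLabel`. -/
def ofLabel (N : ℕ) (l : ℕ × Bool × Bool) : ℕ × Bool := (l.1 / N, xor l.2.2 l.2.1)

variable {N : ℕ}

theorem ofLabel_toLabel (hN : 0 < N) (c : ℕ) (δ : Bool) (l : ℕ × Bool) :
    ofLabel N (toLabel N c δ l) = l := by
  have : leastExponent N c (xor δ l.2) δ < N := Nat.mod_lt _ hN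
  refine Prod.ext ?_ ?_
  · simp [ofLabel, toLabel, Nat.add_mul_div_left _ _ hN, Nat.div_eq_of_lt this]
  · simp [ofLabel, toLabel]

theorem toLabel_injective (hN : 0 < N) (c : ℕ) (δ : Bool) :
    Function.Injective (toLabel N c δ) :=
  Function.LeftInverse.injective (ofLabel_toLabel hN c δ)

theorem dvd_charge_sub_iff (hN : 0 < N) (c : ℕ) (l : ℕ × Bool × Bool) :
    (N : ℤ) ∣ charge l - c ↔ l.1 % N = leastExponent N c l.2.1 l.2.2 := by
  -- The summand `N` in `leastExponent` keeps the natural subtraction from truncating when `c = 0`.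
  have h1 : l.2.1.toNat ≤ c + N + l.2.2.toNat := by
    have := Bool.toNat_le l.2.1
    omega
  have h2 : charge l - c = (l.1 : ℤ) - ((c + N + l.2.2.toNat - l.2.1.toNat : ℕ) : ℤ) + N := by
    rw [Nat.cast_sub h1, charge]
    push_cast
    ring
  rw [h2, dvd_add_self_right, leastExponent]
  exact (Nat.modEq_iff_dvd.symm.trans Nat.ModEq.comm)

theorem dvd_charge_toLabel (hN : 0 < N) (c : ℕ) (δ : Bool) (l : ℕ × Bool) :
    (N : ℤ) ∣ charge (toLabel N c δ l) - c := by
  rw [dvd_charge_sub_iff hN]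
  simp [toLabel, leastExponent]

theorem toLabel_ofLabel (hN : 0 < N) {c : ℕ} {l : ℕ × Bool × Bool}
    (h : (N : ℤ) ∣ charge l - c) : toLabel N c l.2.2 (ofLabel N l) = l := by
  rw [dvd_charge_sub_iff hN] at h
  obtain ⟨m, ε, δ⟩ := l
  simp only at h
  simp [toLabel, ofLabel, ← h, Nat.mod_add_div]

/-- The multiset of labels of charge congruent to `c` modulo `N` built from its labels with last
entry `false` and `true`. -/
def joinLabels (N c : ℕ) (x y : Multiset (ℕ × Bool)) : Multiset (ℕ × Bool × Bool) :=
  x.map (toLabel N c false) + y.map (toLabel N c true)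

theorem filter_map_toLabel (c : ℕ) (δ δ' : Bool) (x : Multiset (ℕ × Bool)) :
    (x.map (toLabel N c δ)).filter (fun l => l.2.2 = δ')
      = if δ = δ' then x.map (toLabel N c δ) else 0 := by
  rw [Multiset.filter_map]
  split_ifs with h
  · congr 1
    exact Multiset.filter_eq_self.2 fun l _ => h
  · rw [Multiset.map_eq_zero]
    exact Multiset.filter_eq_nil.2 fun l _ => h

theorem map_ofLabel_filter_joinLabels (hN : 0 < N) (c : ℕ) (x y : Multiset (ℕ × Bool))
    (δ : Bool) :
    ((joinLabels N c x y).filter fun l => l.2.2 = δ).map (ofLabel N) = bif δ then y else x := by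
  have h : ∀ (δ : Bool) (x : Multiset (ℕ × Bool)),
      (x.map (toLabel N c δ)).map (ofLabel N) = x := fun δ x => by
    rw [Multiset.map_map]
    exact (Multiset.map_congr rfl fun l _ => ofLabel_toLabel hN c δ l).trans x.map_id
  rw [joinLabels, Multiset.filter_add, filter_map_toLabel, filter_map_toLabel]
  cases δ <;> simp [-Multiset.map_map, h]

theorem mem_joinLabels {c : ℕ} {x y : Multiset (ℕ × Bool)} {l : ℕ × Bool × Bool}
    (h : l ∈ joinLabels N c x y) : ∃ δ l', l = toLabel N c δ l' := by
  rcases Multiset.mem_add.1 h with h | h <;> obtain ⟨l', -, rfl⟩ := Multiset.mem_map.1 h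
  exacts [⟨_, _, rfl⟩, ⟨_, _, rfl⟩]

theorem count_joinLabels (hN : 0 < N) (c : ℕ) (x y : Multiset (ℕ × Bool)) (δ : Bool)
    (l : ℕ × Bool) :
    (joinLabels N c x y).count (toLabel N c δ l) = (bif δ then y else x).count l := by
  have h : ∀ (δ' : Bool) (z : Multiset (ℕ × Bool)), δ ≠ δ' →
      (z.map (toLabel N c δ')).count (toLabel N c δ l) = 0 := fun δ' z hδ => by
    refine Multiset.count_eq_zero.2 fun hm => ?_
    obtain ⟨l', -, hl'⟩ := Multiset.mem_map.1 hm
    exact hδ (congrArg (fun l => l.2.2) hl').symm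
  rw [joinLabels, Multiset.count_add]
  cases δ
  · rw [h true y (by simp), Multiset.count_map_eq_count' _ _ (toLabel_injective hN c false)]
    rfl
  · rw [h false x (by simp), Multiset.count_map_eq_count' _ _ (toLabel_injective hN c true),
      zero_add]
    rfl

theorem joinLabels_filter (hN : 0 < N) {c : ℕ} {M : Multiset (ℕ × Bool × Bool)}
    (h : ∀ l ∈ M, (N : ℤ) ∣ charge l - c) :
    joinLabels N c ((M.filter fun l => l.2.2 = false).map (ofLabel N))
      ((M.filter fun l => l.2.2 = true).map (ofLabel N)) = M := by
  have h1 : ∀ δ : Bool, ((M.filter fun l => l.2.2 = δ).map (ofLabel N)).map (toLabel N c δ)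
      = M.filter fun l => l.2.2 = δ := fun δ => by
    rw [Multiset.map_map]
    refine (Multiset.map_congr rfl fun l hl => ?_).trans (Multiset.map_id _)
    rw [Multiset.mem_filter] at hl
    rw [Function.comp_apply, ← hl.2]
    exact toLabel_ofLabel hN (h l hl.1)
  rw [joinLabels, h1, h1]
  have h2 := Multiset.filter_add_not (fun l : ℕ × Bool × Bool => l.2.2 = false) M
  simpa only [Bool.not_eq_false] using h2

theorem card_filter_eq_sum (M : Multiset (ℕ × Bool × Bool)) :
    (M.filter fun l => l.2.2 = true).card = (M.map fun l => l.2.2.toNat).sum := by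
  induction M using Multiset.induction with
  | empty => rfl
  | cons l M ih =>
    rw [Multiset.map_cons, Multiset.sum_cons, ← ih]
    obtain ⟨m, ε, _ | _⟩ := l
    · rw [Multiset.filter_cons_of_neg _ (by simp)]; simp
    · rw [Multiset.filter_cons_of_pos _ (by simp)]; simp [add_comm]

theorem isAdmissible_joinLabels {d e s : ℕ} (hN : 0 < d * e) (hs : s < e) {p r : ℕ}
    (x : SuperMultiset p) (y : SuperMultiset r) :
    IsAdmissible d e (joinLabels (d * e) (d * s) x.1 y.1) := by
  have hc : ∀ l ∈ joinLabels (d * e) (d * s) x.1 y.1,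
      ((d * e : ℕ) : ℤ) ∣ charge l - ((d * s : ℕ) : ℤ) := by
    intro l hl
    obtain ⟨δ, l', rfl⟩ := mem_joinLabels hl
    exact dvd_charge_toLabel hN _ _ _
  refine ⟨fun l hl => ?_, s, hs, fun l h => by simpa using hc l h⟩
  by_cases h : l ∈ joinLabels (d * e) (d * s) x.1 y.1
  · obtain ⟨δ, ⟨k, o⟩, rfl⟩ := mem_joinLabels h
    rw [count_joinLabels hN]
    have ho : o = true := by
      cases o
      · exact absurd (by simp [toLabel]) hl
      · rfl
    subst ho
    cases δ
    exacts [x.2.2 k, y.2.2 k]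
  · rw [Multiset.count_eq_zero.2 h]
    exact zero_le_one

/-- The admissible multisets of labels as triples: the common charge, the labels with last entry
`false`, and those with last entry `true`. -/
def admissibleOfTriple {d e : ℕ} (hN : 0 < d * e) {n r : ℕ} (hr : r ≤ n)
    (u : Fin e × SuperMultiset (n - r) × SuperMultiset r) :
    {M : Multiset (ℕ × Bool × Bool) // IsAdmissible d e M ∧ M.card = n ∧
      (M.map fun l => l.2.2.toNat).sum = r} :=
  ⟨joinLabels (d * e) (d * u.1) u.2.1.1 u.2.2.1, isAdmissible_joinLabels hN u.1.2 _ _, by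
    rw [joinLabels, Multiset.card_add, Multiset.card_map, Multiset.card_map, u.2.1.2.1,
      u.2.2.2.1]; omega, by
    rw [← card_filter_eq_sum, ← Multiset.card_map (ofLabel (d * e)),
      map_ofLabel_filter_joinLabels hN]
    exact u.2.2.2.1⟩

/-- The last entries of the labels separate the two multisets. Any one label has charge congruent to
$ds$ modulo $de$, which determines $s<e$; the assumption $n\ge1$ provides such a label. -/
theorem admissibleOfTriple_bijective {d e : ℕ} (hN : 0 < d * e) {n r : ℕ} (hn : 1 ≤ n)
    (hr : r ≤ n) : Function.Bijective (admissibleOfTriple (d := d) (e := e) hN hr) := by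
  have hd : (d : ℤ) ≠ 0 := by
    have := Nat.pos_of_mul_pos_right hN
    omega
  constructor
  · rintro ⟨s, x, y⟩ ⟨s', x', y'⟩ h
    have hM : joinLabels (d * e) (d * s) x.1 y.1 = joinLabels (d * e) (d * s') x'.1 y'.1 :=
      congrArg Subtype.val h
    have hx : x = x' := Subtype.ext (by
      have := congrArg (fun M => (M.filter fun l => l.2.2 = false).map (ofLabel (d * e))) hM
      simpa only [map_ofLabel_filter_joinLabels hN, cond_true, cond_false] using this)
    have hy : y = y' := Subtype.ext (by
      have := congrArg (fun M => (M.filter fun l => l.2.2 = true).map (ofLabel (d * e))) hM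
      simpa only [map_ofLabel_filter_joinLabels hN, cond_true, cond_false] using this)
    have hs : s = s' := by
      have hcard : (joinLabels (d * e) (d * s) x.1 y.1).card = n :=
        (admissibleOfTriple hN hr (s, x, y)).2.2.1
      obtain ⟨l, hl⟩ := Multiset.card_pos_iff_exists_mem.1
        (by omega : 0 < (joinLabels (d * e) (d * s) x.1 y.1).card)
      have hl' := hM ▸ hl
      obtain ⟨δ, l₁, h1⟩ := mem_joinLabels hl
      obtain ⟨δ', l₂, h2⟩ := mem_joinLabels hl'
      have h3 := dvd_charge_toLabel hN (d * s) δ l₁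
      have h4 := dvd_charge_toLabel hN (d * s') δ' l₂
      rw [← h1] at h3
      rw [← h2] at h4
      have h5 := dvd_sub h4 h3
      have h6 : charge l - ((d * s' : ℕ) : ℤ) - (charge l - ((d * s : ℕ) : ℤ))
          = d * ((s : ℤ) - s') := by push_cast; ring
      rw [h6, Nat.cast_mul] at h5
      have h7 := Int.dvd_of_mul_dvd_mul_left hd h5
      have h8 : ((s : ℕ) : ℤ) - s' = 0 := by
        refine Int.eq_zero_of_abs_lt_dvd h7 ?_
        rw [abs_lt]
        have := s.2
        have := s'.2
        omega
      exact Fin.ext (by omega)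
    rw [hx, hy, hs]
  · rintro ⟨M, ⟨hodd, s, hs, hM⟩, hcard, hsum⟩
    have hM' : ∀ l ∈ M, ((d * e : ℕ) : ℤ) ∣ charge l - ((d * s : ℕ) : ℤ) := fun l hl => by
      simpa using hM l hl
    have hj := joinLabels_filter hN hM'
    have hcount : ∀ (δ : Bool) (k : ℕ),
        ((M.filter fun l => l.2.2 = δ).map (ofLabel (d * e))).count (k, true) ≤ 1 := by
      intro δ k
      have h1 := hodd (toLabel (d * e) (d * s) δ (k, true)) (by simp [toLabel])
      rw [← hj, count_joinLabels hN] at h1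
      cases δ <;> exact h1
    have h1 := congrArg Multiset.card hj
    rw [joinLabels, Multiset.card_add, Multiset.card_map, Multiset.card_map, Multiset.card_map,
      Multiset.card_map, card_filter_eq_sum, hcard, hsum] at h1
    refine ⟨(⟨s, hs⟩, ⟨_, ?_, hcount false⟩, ⟨_, ?_, hcount true⟩), Subtype.ext hj⟩
    · rw [Multiset.card_map]; omega
    · rw [Multiset.card_map, card_filter_eq_sum, hsum]

end

/-! ### The Hilbert series as a sum over charges -/

section

open scoped PowerSeries PowerSeries.WithPiTopology

/-- Summing the monomials `q^{a u} t^{b u}` over a family with finite fibers of `a`. -/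
theorem hasSum_monomial_of_finite {U : Type*} {R : Type*} [CommRing R]
    [TopologicalSpace (Polynomial R)] (a b : U → ℕ) (ha : ∀ i, {u | a u = i}.Finite) (n : ℕ)
    (hb : ∀ u, b u ≤ n) :
    HasSum (fun u => PowerSeries.monomial (a u) (Polynomial.monomial (b u) (1 : R)))
      (PowerSeries.mk fun i => ∑ k ∈ Finset.range (n + 1),
        Polynomial.monomial k (Nat.card {u // a u = i ∧ b u = k} : R)) := by
  classical
  rw [PowerSeries.WithPiTopology.hasSum_iff_hasSum_coeff]
  intro i
  have h1 : ∑ u ∈ (ha i).toFinset, Polynomial.monomial (b u) (1 : R)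
      = ∑ k ∈ Finset.range (n + 1),
        Polynomial.monomial k (Nat.card {u // a u = i ∧ b u = k} : R) := by
    rw [← Finset.sum_fiberwise_of_maps_to (s := (ha i).toFinset) (t := Finset.range (n + 1))
      (g := b) fun u _ => Finset.mem_range.2 (Nat.lt_succ_of_le (hb u))]
    refine Finset.sum_congr rfl fun k _ => ?_
    have h2 : Nat.card {u // a u = i ∧ b u = k}
        = ((ha i).toFinset.filter fun u => b u = k).card := 
      Nat.subtype_card _ fun u => by simp
    rw [Finset.sum_congr rfl fun u hu => by rw [(Finset.mem_filter.1 hu).2], Finset.sum_const,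
      h2, ← map_nsmul, nsmul_one]
  rw [PowerSeries.coeff_mk, ← h1]
  have h3 : ∑ u ∈ (ha i).toFinset, Polynomial.monomial (b u) (1 : R)
      = ∑ u ∈ (ha i).toFinset,
        PowerSeries.coeff i (PowerSeries.monomial (a u) (Polynomial.monomial (b u) (1 : R))) :=
    Finset.sum_congr rfl fun u hu => by
      rw [Set.Finite.mem_toFinset] at hu
      rw [PowerSeries.coeff_monomial, if_pos hu.symm]
  rw [h3]
  refine hasSum_sum_of_ne_finset_zero fun u hu => ?_
  rw [Set.Finite.mem_toFinset] at hu
  rw [PowerSeries.coeff_monomial, if_neg fun h => hu h.symm]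

variable {N : ℕ}

/-- For fixed `δ`, bosons ($\varepsilon=\delta$) and fermions ($\varepsilon\ne\delta$) each have
weights in geometric progression with ratio $q^N$, as the $q$-binomial theorem requires. -/
theorem prod_map_toLabel {R : Type*} [CommRing R] (q t : R) (c : ℕ) (δ : Bool)
    (x : Multiset (ℕ × Bool)) :
    q ^ ((x.map (toLabel N c δ)).map fun l => l.1).sum *
        t ^ ((x.map (toLabel N c δ)).map fun l => l.2.1.toNat).sum
      = (x.map (elementWeight (q ^ leastExponent N c δ δ * t ^ δ.toNat)
          (q ^ leastExponent N c (!δ) δ * t ^ (!δ).toNat) (q ^ N))).prod := by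
  induction x using Multiset.induction with
  | empty => simp
  | cons l x ih =>
    simp only [Multiset.map_cons, Multiset.sum_cons, Multiset.prod_cons, pow_add, ← ih]
    obtain ⟨k, o⟩ := l
    have : elementWeight (q ^ leastExponent N c δ δ * t ^ δ.toNat)
          (q ^ leastExponent N c (!δ) δ * t ^ (!δ).toNat) (q ^ N) (k, o)
        = q ^ (toLabel N c δ (k, o)).1 * t ^ (toLabel N c δ (k, o)).2.1.toNat := by
      cases o <;> simp [elementWeight, toLabel, pow_add, pow_mul] <;> ring
    rw [this]
    ring

theorem sum_fst_le_sum_toLabel (hN : 0 < N) (c : ℕ) (δ : Bool) (x : Multiset (ℕ × Bool)) :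
    (x.map Prod.fst).sum ≤ ((x.map (toLabel N c δ)).map fun l => l.1).sum := by
  rw [Multiset.map_map]
  refine Multiset.sum_map_le_sum_map _ _ fun l _ => ?_
  exact (Nat.le_mul_of_pos_left _ hN).trans (Nat.le_add_left _ _)

/-- Summation in stages: the finite index outside, and for each of its values a double sum that
factors. -/
theorem eq_sum_tsum_mul_tsum {M : Type*} [CommRing M] [TopologicalSpace M] [IsTopologicalRing M]
    [T2Space M] {e : ℕ} {X Y : Type*} {F : Fin e → X → M} {G : Fin e → Y → M} {H : M}
    (hF : ∀ s, Summable (F s)) (hG : ∀ s, Summable (G s))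
    (hFG : ∀ s, Summable fun p : X × Y => F s p.1 * G s p.2)
    (hH : HasSum (fun u : Fin e × X × Y => F u.1 u.2.1 * G u.1 u.2.2) H) :
    H = ∑ s, (∑' x, F s x) * ∑' y, G s y := by
  refine (HasSum.prod_fiberwise (β := Fin e) (γ := X × Y) hH fun s => ?_).unique
    (hasSum_fintype fun s => (∑' x, F s x) * ∑' y, G s y)
  have h := (hF s).hasSum.mul (hG s).hasSum (hFG s)
  exact h

/-- The Hilbert series of `(S(V^*) ⊗ ∧V^* ⊗ ∧^r V)^W`, for `W = G(de,e,n)`, as a sum over pairs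
of multisets. -/
theorem hasSum_hilbertPowerSeries [TopologicalSpace (Polynomial ℚ)] {d e n r : ℕ} (hd : 1 ≤ d)
    (he : 1 ≤ e) (hn : 1 ≤ n) (hr : r ≤ n) (q t : (Polynomial ℚ)⟦X⟧) (hq : q = PowerSeries.X)
    (ht : t = PowerSeries.C Polynomial.X) :
    HasSum (fun u : Fin e × SuperMultiset (n - r) × SuperMultiset r =>
        u.2.1.weight (q ^ leastExponent (d * e) (d * u.1) false false)
            (q ^ leastExponent (d * e) (d * u.1) true false * t) (q ^ (d * e)) *
          u.2.2.weight (q ^ leastExponent (d * e) (d * u.1) true true * t)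
            (q ^ leastExponent (d * e) (d * u.1) false true) (q ^ (d * e)))
      (hilbertPowerSeries (shephardTodd d e n) (wedgeRep (shephardTodd d e n) r)) := by
  classical
  have hN : 0 < d * e := Nat.mul_pos hd he
  let U := Fin e × SuperMultiset (n - r) × SuperMultiset r
  let E : U ≃ _ := Equiv.ofBijective _ (admissibleOfTriple_bijective hN hn hr)
  let a : U → ℕ := fun u => ((E u).1.map fun l => l.1).sum
  let b : U → ℕ := fun u => ((E u).1.map fun l => l.2.1.toNat).sum
  have ha' : ∀ u : U, a u = ((u.2.1.1.map (toLabel (d * e) (d * u.1) false)).map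
      fun l => l.1).sum + ((u.2.2.1.map (toLabel (d * e) (d * u.1) true)).map
      fun l => l.1).sum := fun u => by
    change ((joinLabels _ _ _ _).map _).sum = _
    rw [joinLabels, Multiset.map_add, Multiset.sum_add]
  have hb' : ∀ u : U, b u = ((u.2.1.1.map (toLabel (d * e) (d * u.1) false)).map
      fun l => l.2.1.toNat).sum + ((u.2.2.1.map (toLabel (d * e) (d * u.1) true)).map
      fun l => l.2.1.toNat).sum := fun u => by
    change ((joinLabels _ _ _ _).map _).sum = _
    rw [joinLabels, Multiset.map_add, Multiset.sum_add]
  have ha : ∀ i, {u | a u = i}.Finite := by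
    intro i
    refine ((Set.finite_univ (α := Fin e)).prod ((finite_superMultiset_le (n - r) i).prod
      (finite_superMultiset_le r i))).subset fun u hu => ?_
    have hu' : a u = i := hu
    have h1 := sum_fst_le_sum_toLabel hN (d * u.1) false u.2.1.1
    have h2 := sum_fst_le_sum_toLabel hN (d * u.1) true u.2.2.1
    have h3 := ha' u
    refine ⟨Set.mem_univ _, ?_, ?_⟩
    · change (u.2.1.1.map Prod.fst).sum ≤ i
      omega
    · change (u.2.2.1.map Prod.fst).sum ≤ i
      omega
  -- Each label contributes at most 1 to the exterior degree, so truncating at $t^n$ loses nothing.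
  have hb : ∀ u, b u ≤ n := by
    intro u
    have h1 : b u ≤ ((E u).1.map fun _ => 1).sum :=
      Multiset.sum_map_le_sum_map _ _ fun l _ => Bool.toNat_le _
    rw [Multiset.map_const', Multiset.sum_replicate, (E u).2.2.1, smul_eq_mul, mul_one] at h1
    exact h1
  have hH := hasSum_monomial_of_finite (R := ℚ) a b ha n hb
  have hhilb : hilbertPowerSeries (shephardTodd d e n) (wedgeRep (shephardTodd d e n) r)
      = PowerSeries.mk fun i => ∑ k ∈ Finset.range (n + 1),
        Polynomial.monomial k (Nat.card {u // a u = i ∧ b u = k} : ℚ) := by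
    refine congrArg PowerSeries.mk (funext fun i => Finset.sum_congr rfl fun k _ => ?_)
    rw [finrank_mixedInvariants hd he hn i k r]
    congr 2
    refine Nat.card_congr (Equiv.symm ?_)
    refine (E.subtypeEquiv (q := fun M => (M.1.map fun l => l.1).sum = i ∧
      (M.1.map fun l => l.2.1.toNat).sum = k) fun u => Iff.rfl).trans ?_
    refine (Equiv.subtypeSubtypeEquivSubtypeInter _ (fun M : Multiset (ℕ × Bool × Bool) => (M.map fun l => l.1).sum = i ∧
      (M.map fun l => l.2.1.toNat).sum = k)).trans (Equiv.subtypeEquivRight fun M => ?_)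
    tauto
  rw [← hhilb] at hH
  have hw : ∀ u : U, PowerSeries.monomial (a u) (Polynomial.monomial (b u) (1 : ℚ))
      = u.2.1.weight (q ^ leastExponent (d * e) (d * u.1) false false)
            (q ^ leastExponent (d * e) (d * u.1) true false * t) (q ^ (d * e)) *
        u.2.2.weight (q ^ leastExponent (d * e) (d * u.1) true true * t)
            (q ^ leastExponent (d * e) (d * u.1) false true) (q ^ (d * e)) := by
    intro u
    have h0 := prod_map_toLabel (N := d * e) q t (d * u.1) false u.2.1.1
    have h1 := prod_map_toLabel (N := d * e) q t (d * u.1) true u.2.2.1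
    simp only [Bool.toNat_false, Bool.toNat_true, Bool.not_false, Bool.not_true, pow_zero,
      pow_one, mul_one] at h0 h1
    have h2 : PowerSeries.monomial (a u) (Polynomial.monomial (b u) (1 : ℚ))
        = q ^ a u * t ^ b u := by
      rw [hq, ht, ← map_pow, Polynomial.X_pow_eq_monomial, mul_comm,
        ← PowerSeries.monomial_eq_C_mul_X_pow]
    rw [h2, ha', hb', SuperMultiset.weight, SuperMultiset.weight, ← h0, ← h1, pow_add, pow_add]
    ring
  exact hasSum_of_eq hH fun u => (hw u).symm

theorem summable_weight_mul_weight {R : Type*} [CommRing R] [TopologicalSpace R] {n r : ℕ}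
    (A₀ B₀ A₁ B₁ : R⟦X⟧) {Q : R⟦X⟧} (hQ : PowerSeries.X ∣ Q) :
    Summable fun p : SuperMultiset n × SuperMultiset r =>
      p.1.weight A₀ B₀ Q * p.2.weight A₁ B₁ Q := by
  refine summable_of_finite_coeff_ne_zero fun i => ((finite_superMultiset_le n i).prod
    (finite_superMultiset_le r i)).subset fun u hu => ?_
  have h := mul_dvd_mul (X_pow_dvd_prod_elementWeight A₀ B₀ Q hQ u.1.1)
    (X_pow_dvd_prod_elementWeight A₁ B₁ Q hQ u.2.1)
  rw [← pow_add] at h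
  have h1 : (u.1.1.map Prod.fst).sum + (u.2.1.map Prod.fst).sum ≤ i := by
    by_contra h2
    exact hu (PowerSeries.X_pow_dvd_iff.1 h i (not_le.1 h2))
  exact ⟨(Nat.le_add_right _ _).trans h1, (Nat.le_add_left _ _).trans h1⟩

/-- The Hilbert series of `(S(V^*) ⊗ ∧V^* ⊗ ∧^r V)^W`, for `W = G(de,e,n)`, as a sum over the
characters of the diagonal matrices modulo those trivial on the diagonal matrices in `W`. -/
theorem hilbertPowerSeries_wedgeRep {d e n r : ℕ} (hd : 1 ≤ d) (he : 1 ≤ e) (hn : 1 ≤ n)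
    (hr : r ≤ n) (q t : (Polynomial ℚ)⟦X⟧) (hq : q = PowerSeries.X)
    (ht : t = PowerSeries.C Polynomial.X) :
    ((∏ i ∈ Finset.range (n - r), (1 - (q ^ (d * e)) ^ (i + 1))) *
        ∏ i ∈ Finset.range r, (1 - (q ^ (d * e)) ^ (i + 1))) *
      hilbertPowerSeries (shephardTodd d e n) (wedgeRep (shephardTodd d e n) r)
      = ∑ s ∈ Finset.range e,
        (∏ i ∈ Finset.range (n - r), (q ^ leastExponent (d * e) (d * s) false false +
            q ^ leastExponent (d * e) (d * s) true false * t * (q ^ (d * e)) ^ i)) *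
          ∏ i ∈ Finset.range r, (q ^ leastExponent (d * e) (d * s) true true * t +
            q ^ leastExponent (d * e) (d * s) false true * (q ^ (d * e)) ^ i) := by
  let _ : TopologicalSpace (Polynomial ℚ) := ⊥
  have : DiscreteTopology (Polynomial ℚ) := ⟨rfl⟩
  have hQ : PowerSeries.X ∣ q ^ (d * e) := by
    rw [hq]
    exact dvd_pow_self _ (Nat.mul_pos hd he).ne'
  have hS := eq_sum_tsum_mul_tsum
    (F := fun (s : Fin e) (x : SuperMultiset (n - r)) =>
      x.weight (q ^ leastExponent (d * e) (d * s) false false)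
        (q ^ leastExponent (d * e) (d * s) true false * t) (q ^ (d * e)))
    (G := fun (s : Fin e) (y : SuperMultiset r) =>
      y.weight (q ^ leastExponent (d * e) (d * s) true true * t)
        (q ^ leastExponent (d * e) (d * s) false true) (q ^ (d * e)))
    (fun _ => summable_weight _ _ _ hQ _) (fun _ => summable_weight _ _ _ hQ _)
    (fun _ => summable_weight_mul_weight _ _ _ _ hQ)
    (hasSum_hilbertPowerSeries hd he hn hr q t hq ht)
  rw [hS, Finset.mul_sum, ← Fin.sum_univ_eq_sum_range]
  refine Finset.sum_congr rfl fun s _ => ?_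
  rw [mul_mul_mul_comm, tsum_weight _ _ _ hQ, tsum_weight _ _ _ hQ]

end

/-! ### Summing over the charges -/

section

section LeastExponent

variable {N c : ℕ}

theorem leastExponent_self (hc : c < N) (ε : Bool) : leastExponent N c ε ε = c := by
  rw [leastExponent, Nat.add_sub_cancel, Nat.add_mod_right, Nat.mod_eq_of_lt hc]

theorem leastExponent_true_false (hc : c < N) (h0 : 1 ≤ c) :
    leastExponent N c true false = c - 1 := by
  have h : c + N + 0 - 1 = c - 1 + N := by omega
  rw [leastExponent, Bool.toNat_false, Bool.toNat_true, h, Nat.add_mod_right,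
    Nat.mod_eq_of_lt (by omega)]

theorem leastExponent_zero_true_false (hN : 1 ≤ N) :
    leastExponent N 0 true false = N - 1 := by
  rw [leastExponent, Bool.toNat_false, Bool.toNat_true, Nat.zero_add, Nat.add_zero,
    Nat.mod_eq_of_lt (by omega)]

theorem leastExponent_false_true (hc : c + 1 < N) :
    leastExponent N c false true = c + 1 := by
  have h : c + N + 1 - 0 = c + 1 + N := by omega
  rw [leastExponent, Bool.toNat_false, Bool.toNat_true, h, Nat.add_mod_right,
    Nat.mod_eq_of_lt hc]

theorem leastExponent_false_true_of_eq (hc : c + 1 = N) :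
    leastExponent N c false true = 0 := by
  have h : c + N + 1 - 0 = N + N := by omega
  rw [leastExponent, Bool.toNat_false, Bool.toNat_true, h, Nat.add_mod_right, Nat.mod_self]

end LeastExponent

variable {K : Type*} [Field K]

/-- The product `(t + q)(t + qQ) ⋯ (t + qQ^(r-1))`. -/
def fermionProduct (q t Q : K) (r : ℕ) : K := ∏ i ∈ Finset.range r, (t + q * Q ^ i)

theorem fermionProduct_succ (q t Q : K) (r : ℕ) :
    fermionProduct q t Q (r + 1) = fermionProduct q t Q r * (t + q * Q ^ r) :=
  Finset.prod_range_succ _ _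

/-- The product started one step earlier has the same factors after its first; this exposes the
common part with the unwrapped products. -/
theorem fermionProduct_div_succ (q t : K) {Q : K} (hQ : Q ≠ 0) (r : ℕ) :
    fermionProduct (q / Q) t Q (r + 1) = (t + q / Q) * fermionProduct q t Q r := by
  rw [fermionProduct, Finset.prod_range_succ', mul_comm, pow_zero, mul_one, fermionProduct]
  congr 1
  refine Finset.prod_congr rfl fun i _ => ?_
  rw [pow_succ]
  field_simp

/-- Each factor is $t+qQ^i=qQ^i(1+tq^{-1}Q^{-i})$; the exponents $i$ add up to $\binom r2$. Hence
the base $Q^{-1}$ in the final formulas. -/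
theorem fermionProduct_eq {q Q : K} (hq : q ≠ 0) (hQ : Q ≠ 0) (t : K) (r : ℕ) :
    fermionProduct q t Q r = q ^ r * Q ^ r.choose 2 * qPochhammer (-t * q⁻¹) Q⁻¹ r := by
  induction r with
  | zero => simp [fermionProduct, qPochhammer]
  | succ r ih =>
    have h : (r + 1).choose 2 = r.choose 2 + r := by
      rw [Nat.choose_succ_succ, Nat.choose_one_right, add_comm]
    rw [fermionProduct_succ, ih, h, qPochhammer, qPochhammer, Finset.prod_range_succ, pow_succ,
      pow_add, inv_pow]
    field_simp
    ring

theorem qPochhammer_succ (z p : K) (k : ℕ) :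
    qPochhammer z p (k + 1) = qPochhammer z p k * (1 - z * p ^ k) :=
  Finset.prod_range_succ _ _

theorem qPochhammer_succ' (z p : K) (k : ℕ) :
    qPochhammer z p (k + 1) = (1 - z) * qPochhammer (z * p) p k := by
  rw [qPochhammer, Finset.prod_range_succ', mul_comm, pow_zero, mul_one, qPochhammer]
  congr 1
  exact Finset.prod_congr rfl fun i _ => by rw [pow_succ]; ring

theorem qPochhammer_self (Q : K) (k : ℕ) :
    qPochhammer Q Q k = ∏ i ∈ Finset.range k, (1 - Q ^ (i + 1)) :=
  Finset.prod_congr rfl fun i _ => by rw [pow_succ']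

theorem qPochhammer_self_ne_zero {Q : K} (hQ : ∀ k, 1 ≤ k → Q ^ k ≠ 1) (k : ℕ) :
    qPochhammer Q Q k ≠ 0 := by
  rw [qPochhammer_self]
  exact Finset.prod_ne_zero_iff.2 fun i _ => sub_ne_zero.2 (hQ _ (Nat.le_add_left _ _)).symm

/-- The summand of the Hilbert series belonging to the charge `c` modulo `N`. -/
def chargeTerm (q t : K) (N c p r : ℕ) : K :=
  (∏ i ∈ Finset.range p, (q ^ leastExponent N c false false +
      q ^ leastExponent N c true false * t * (q ^ N) ^ i)) *
    ∏ i ∈ Finset.range r, (q ^ leastExponent N c true true * t +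
      q ^ leastExponent N c false true * (q ^ N) ^ i)

theorem prod_boson_of_pos {q : K} (hq : q ≠ 0) (t : K) {N c : ℕ} (hc : c < N) (h0 : 1 ≤ c)
    (p : ℕ) :
    ∏ i ∈ Finset.range p, (q ^ leastExponent N c false false +
      q ^ leastExponent N c true false * t * (q ^ N) ^ i)
      = q ^ (c * p) * qPochhammer (-t * q⁻¹) (q ^ N) p := by
  rw [leastExponent_self hc, leastExponent_true_false hc h0, pow_mul, qPochhammer,
    Finset.pow_eq_prod_const (q ^ c) p, ← Finset.prod_mul_distrib]
  refine Finset.prod_congr rfl fun i _ => ?_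
  obtain ⟨c, rfl⟩ := Nat.exists_eq_add_of_le' h0
  rw [Nat.add_sub_cancel, pow_succ]
  field_simp
  ring

theorem prod_boson_zero (q t : K) {N : ℕ} (hN : 1 ≤ N) (p : ℕ) :
    ∏ i ∈ Finset.range p, (q ^ leastExponent N 0 false false +
      q ^ leastExponent N 0 true false * t * (q ^ N) ^ i)
      = qPochhammer (-t * q ^ (N - 1)) (q ^ N) p := by
  rw [leastExponent_self hN, leastExponent_zero_true_false hN, qPochhammer]
  exact Finset.prod_congr rfl fun i _ => by ring

theorem prod_fermion_of_lt (q t : K) {N c : ℕ} (hc : c + 1 < N) (r : ℕ) :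
    ∏ i ∈ Finset.range r, (q ^ leastExponent N c true true * t +
      q ^ leastExponent N c false true * (q ^ N) ^ i)
      = q ^ (c * r) * fermionProduct q t (q ^ N) r := by
  rw [leastExponent_self (by omega), leastExponent_false_true hc, pow_mul, fermionProduct,
    Finset.pow_eq_prod_const (q ^ c) r, ← Finset.prod_mul_distrib]
  exact Finset.prod_congr rfl fun i _ => by ring

theorem prod_fermion_of_eq {q : K} (hq : q ≠ 0) (t : K) {N c : ℕ} (hc : c + 1 = N) (r : ℕ) :
    ∏ i ∈ Finset.range r, (q ^ leastExponent N c true true * t +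
      q ^ leastExponent N c false true * (q ^ N) ^ i)
      = q ^ (c * r) * fermionProduct (q / q ^ N) t (q ^ N) r := by
  rw [leastExponent_self (by omega), leastExponent_false_true_of_eq hc, pow_mul, fermionProduct,
    Finset.pow_eq_prod_const (q ^ c) r, ← Finset.prod_mul_distrib]
  refine Finset.prod_congr rfl fun i _ => ?_
  have h : q ^ c * (q / q ^ N) = 1 := by
    rw [← hc, pow_succ]
    field_simp
  rw [pow_zero, mul_add, ← mul_assoc, h]

theorem chargeTerm_zero (q t : K) {N : ℕ} (hN : 2 ≤ N) (p r : ℕ) :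
    chargeTerm q t N 0 p r
      = qPochhammer (-t * q ^ (N - 1)) (q ^ N) p * fermionProduct q t (q ^ N) r := by
  rw [chargeTerm, prod_boson_zero q t (by omega), prod_fermion_of_lt q t (by omega), zero_mul,
    pow_zero, one_mul]

theorem chargeTerm_of_lt {q : K} (hq : q ≠ 0) (t : K) {N c : ℕ} (h0 : 1 ≤ c) (hc : c + 1 < N)
    (p r : ℕ) :
    chargeTerm q t N c p r = q ^ (c * (p + r)) *
      (qPochhammer (-t * q⁻¹) (q ^ N) p * fermionProduct q t (q ^ N) r) := by
  rw [chargeTerm, prod_boson_of_pos hq t (by omega) h0, prod_fermion_of_lt q t hc, mul_add,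
    pow_add]
  ring

theorem chargeTerm_of_eq {q : K} (hq : q ≠ 0) (t : K) {N c : ℕ} (h0 : 1 ≤ c) (hc : c + 1 = N)
    (p r : ℕ) :
    chargeTerm q t N c p r = q ^ (c * (p + r)) *
      (qPochhammer (-t * q⁻¹) (q ^ N) p * fermionProduct (q / q ^ N) t (q ^ N) r) := by
  rw [chargeTerm, prod_boson_of_pos hq t (by omega) h0, prod_fermion_of_eq hq t hc, mul_add,
    pow_add]
  ring

/-- For $d\ge2$ no charge $ds<de$ equals $de-1$, so only $s=0$ is exceptional. The remaining terms
are geometric with ratio $q^{d(p+r)}$, and the prefactor clears the denominator. -/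
theorem sum_chargeTerm_of_two_le {q : K} (hq : q ≠ 0) (t : K) {d e : ℕ} (hd : 2 ≤ d)
    (he : 1 ≤ e) (p r : ℕ) :
    (1 - q ^ (d * (p + r))) * ∑ s ∈ Finset.range e, chargeTerm q t (d * e) (d * s) p r
      = fermionProduct q t (q ^ (d * e)) r *
        ((1 - q ^ (d * (p + r))) * qPochhammer (-t * q ^ (d * e - 1)) (q ^ (d * e)) p +
          (q ^ (d * (p + r)) - (q ^ (d * e)) ^ (p + r)) *
            qPochhammer (-t * q⁻¹) (q ^ (d * e)) p) := by
  obtain ⟨e, rfl⟩ := Nat.exists_eq_add_of_le' he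
  rw [Finset.sum_range_succ', mul_zero, chargeTerm_zero q t (by nlinarith)]
  have h1 : ∀ s ∈ Finset.range e, chargeTerm q t (d * (e + 1)) (d * (s + 1)) p r
      = (q ^ (d * (p + r))) ^ s * (q ^ (d * (p + r)) *
        (qPochhammer (-t * q⁻¹) (q ^ (d * (e + 1))) p *
          fermionProduct q t (q ^ (d * (e + 1))) r)) := by
    intro s hs
    have h2 : s + 1 ≤ e := Finset.mem_range.1 hs
    rw [chargeTerm_of_lt hq t (by nlinarith) (by nlinarith)]
    ring
  rw [Finset.sum_congr rfl h1, ← Finset.sum_mul]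
  have h3 := mul_neg_geom_sum (q ^ (d * (p + r))) e
  have h4 : (q ^ (d * (e + 1))) ^ (p + r) = q ^ (d * (p + r)) * (q ^ (d * (p + r))) ^ e := by
    ring
  rw [h4]
  linear_combination (q ^ (d * (p + r)) * (qPochhammer (-t * q⁻¹) (q ^ (d * (e + 1))) p *
    fermionProduct q t (q ^ (d * (e + 1))) r)) * h3

/-- Here both ends are exceptional: charge $0$, and charge $e-1$, where the fermion product starts
at $q/q^e$. The middle charges form a geometric series, empty for $e=2$. -/
theorem sum_chargeTerm_of_one {q : K} (hq : q ≠ 0) (t : K) {e : ℕ} (he : 2 ≤ e) (p r : ℕ) :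
    (1 - q ^ (p + r)) * ∑ s ∈ Finset.range e, chargeTerm q t e s p r
      = fermionProduct q t (q ^ e) r *
        ((1 - q ^ (p + r)) * qPochhammer (-t * q ^ (e - 1)) (q ^ e) p +
          (q ^ (p + r) - q ^ ((p + r) * (e - 1))) * qPochhammer (-t * q⁻¹) (q ^ e) p) +
        (1 - q ^ (p + r)) * q ^ ((p + r) * (e - 1)) * (qPochhammer (-t * q⁻¹) (q ^ e) p *
          fermionProduct (q / q ^ e) t (q ^ e) r) := by
  obtain ⟨e, rfl⟩ := Nat.exists_eq_add_of_le' he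
  rw [Finset.sum_range_succ, Finset.sum_range_succ', chargeTerm_zero q t (by omega),
    chargeTerm_of_eq hq t (by omega) rfl]
  have h1 : ∀ s ∈ Finset.range e, chargeTerm q t (e + 2) (s + 1) p r
      = (q ^ (p + r)) ^ s * (q ^ (p + r) *
        (qPochhammer (-t * q⁻¹) (q ^ (e + 2)) p * fermionProduct q t (q ^ (e + 2)) r)) := by
    intro s hs
    have h2 : s + 1 ≤ e := Finset.mem_range.1 hs
    rw [chargeTerm_of_lt hq t (by omega) (by omega)]
    ring
  rw [Finset.sum_congr rfl h1, ← Finset.sum_mul]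
  have h3 := mul_neg_geom_sum (q ^ (p + r)) e
  have h4 : q ^ ((p + r) * (e + 1)) = q ^ (p + r) * (q ^ (p + r)) ^ e := by
    ring
  have h5 : (e + 1) * (p + r) = (p + r) * (e + 1) := mul_comm _ _
  rw [show e + 2 - 1 = e + 1 from rfl, h5, h4]
  linear_combination (q ^ (p + r) * (qPochhammer (-t * q⁻¹) (q ^ (e + 2)) p *
    fermionProduct q t (q ^ (e + 2)) r)) * h3

end

/-! ### Passage to Laurent series, and duality -/

section

theorem qVar_pow (k : ℕ) : qVar ^ k = HahnSeries.single (k : ℤ) 1 := by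
  rw [qVar, HahnSeries.single_pow, one_pow, nsmul_one]

theorem qVar_ne_zero : qVar ≠ 0 := HahnSeries.single_ne_zero one_ne_zero

theorem qVar_pow_ne_one {k : ℕ} (hk : 1 ≤ k) : qVar ^ k ≠ 1 := by
  intro h
  have h1 := congrArg (fun x : SeriesField => x.coeff 0) h
  simp only [qVar_pow, HahnSeries.coeff_one, if_true] at h1
  rw [HahnSeries.coeff_single_of_ne (by omega)] at h1
  exact zero_ne_one h1

theorem seriesEmbedding_X : seriesEmbedding PowerSeries.X = qVar := by
  rw [seriesEmbedding, RingHom.comp_apply, PowerSeries.map_X, HahnSeries.ofPowerSeries_X]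
  rfl

theorem seriesEmbedding_C_X : seriesEmbedding (PowerSeries.C Polynomial.X) = tVar := by
  rw [seriesEmbedding, RingHom.comp_apply, PowerSeries.map_C, HahnSeries.ofPowerSeries_C,
    RatFunc.algebraMap_X]
  rfl

theorem qPochhammer_mul_Hilb_wedgeRep {d e n r : ℕ} (hd : 1 ≤ d) (he : 1 ≤ e) (hn : 1 ≤ n)
    (hr : r ≤ n) :
    (qPochhammer (qVar ^ (d * e)) (qVar ^ (d * e)) (n - r) *
        qPochhammer (qVar ^ (d * e)) (qVar ^ (d * e)) r) *
      Hilb (shephardTodd d e n) (wedgeRep (shephardTodd d e n) r)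
      = ∑ s ∈ Finset.range e, chargeTerm qVar tVar (d * e) (d * s) (n - r) r := by
  have h := congrArg seriesEmbedding (hilbertPowerSeries_wedgeRep hd he hn hr _ _ rfl rfl)
  simp only [map_mul, map_sum, map_prod, map_sub, map_add, map_one, map_pow, seriesEmbedding_X,
    seriesEmbedding_C_X] at h
  rw [qPochhammer_self, qPochhammer_self]
  exact h

theorem finrank_mixedInvariants_congr {n : ℕ} (W : Subgroup (GL (Fin n) ℂ)) {U U' : Type*}
    [AddCommGroup U] [Module ℂ U] [AddCommGroup U'] [Module ℂ U'] (τ : Representation ℂ W U)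
    (τ' : Representation ℂ W U') (f : U ≃ₗ[ℂ] U') (hf : ∀ w u, f (τ w u) = τ' w (f u))
    (i k : ℕ) :
    Module.finrank ℂ (mixedInvariants W τ i k) = Module.finrank ℂ (mixedInvariants W τ' i k) := by
  let F : MixedSpace n i k U ≃ₗ[ℂ] MixedSpace n i k U' :=
    TensorProduct.congr (LinearEquiv.refl ℂ _) (TensorProduct.congr (LinearEquiv.refl ℂ _) f)
  have hF : ∀ w x, F (mixedRep W τ i k w x) = mixedRep W τ' i k w (F x) := by
    intro w x
    have h : F.toLinearMap ∘ₗ mixedRep W τ i k w = mixedRep W τ' i k w ∘ₗ F.toLinearMap := by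
      refine TensorProduct.ext ?_
      refine LinearMap.ext fun p => ?_
      refine TensorProduct.ext' fun a u => ?_
      simp [F, mixedRep, hf]
    exact LinearMap.congr_fun h x
  have hmap : (mixedInvariants W τ i k).map F.toLinearMap = mixedInvariants W τ' i k := by
    ext y
    constructor
    · rintro ⟨x, hx, rfl⟩ w
      exact (hF w x).symm.trans (congrArg F (hx w))
    · intro hy
      refine ⟨F.symm y, fun w => F.injective ?_, F.apply_symm_apply y⟩
      rw [hF, F.apply_symm_apply]
      exact hy w
  rw [← hmap]
  exact (LinearEquiv.finrank_map_eq F _).symm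

/-- Evaluation is an equivariant isomorphism of a reflexive space with its double dual. -/
theorem Hilb_eq_isotypicSeries_dual {n : ℕ} (W : Subgroup (GL (Fin n) ℂ)) {U : Type*}
    [AddCommGroup U] [Module ℂ U] [Module.IsReflexive ℂ U] (τ : Representation ℂ W U) :
    Hilb W τ = isotypicSeries W τ.dual := by
  refine congrArg seriesEmbedding (congrArg PowerSeries.mk (funext fun i =>
    Finset.sum_congr rfl fun k _ => ?_))
  rw [finrank_mixedInvariants_congr W τ τ.dual.dual (Module.evalEquiv ℂ U) (fun w u => ?_) i k]
  ext φ
  simp [Representation.dual_apply, Module.Dual.transpose_apply]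

/-! ### Closed forms -/

section ClosedForms

variable {K : Type*} [Field K] {q t H : K} {n r : ℕ}

/-- Put $Q=q^{de}$ and $x=q^{dn}$. Both terms contain $(-tq^{-1}Q;Q)_{n-1}$, and the cofactor
$(1-x)(1+tq^{-1}Q^n)+(x-Q^n)(1+tq^{-1})$ equals $(1-Q^n)(1+tq^{-1}x)$. The factor $1-Q^n$ cancels
the last one of $(Q;Q)_n$. -/
theorem closedForm_zero {d e : ℕ} (hq : q ≠ 0) (hq1 : ∀ k, 1 ≤ k → q ^ k ≠ 1) (hd : 1 ≤ d)
    (he : 1 ≤ e) (hn : 1 ≤ n)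
    (h : qPochhammer (q ^ (d * e)) (q ^ (d * e)) n * ((1 - q ^ (d * n)) * H)
      = (1 - q ^ (d * n)) * qPochhammer (-t * q ^ (d * e - 1)) (q ^ (d * e)) n +
          (q ^ (d * n) - (q ^ (d * e)) ^ n) * qPochhammer (-t * q⁻¹) (q ^ (d * e)) n) :
    H = (qPochhammer (-t * q ^ (d * e - 1)) (q ^ (d * e)) (n - 1) * (1 + t * q ^ (d * n - 1)))
      / (qPochhammer (q ^ (d * e)) (q ^ (d * e)) (n - 1) * (1 - q ^ (d * n))) := by
  have hN : 1 ≤ d * e := Nat.mul_pos hd he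
  have hQ : ∀ k, 1 ≤ k → (q ^ (d * e)) ^ k ≠ 1 := fun k hk => by
    rw [← pow_mul]
    exact hq1 _ (Nat.mul_pos hN hk)
  have h1 : q ^ (d * e - 1) = q⁻¹ * q ^ (d * e) := by
    rw [pow_sub₀ q hq hN, pow_one, mul_comm]
  have h2 : q ^ (d * n - 1) = q⁻¹ * q ^ (d * n) := by
    rw [pow_sub₀ q hq (Nat.mul_pos hd hn), pow_one, mul_comm]
  obtain ⟨m, rfl⟩ := Nat.exists_eq_add_of_le' hn
  rw [h1] at h
  rw [Nat.add_sub_cancel, h1, h2]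
  have hP := qPochhammer_self_ne_zero hQ m
  have h3 := sub_ne_zero.2 (hq1 _ (Nat.mul_pos hd hn)).symm
  have h4 := sub_ne_zero.2 (hQ (m + 1) hn).symm
  rw [eq_div_iff (mul_ne_zero hP h3)]
  rw [qPochhammer_succ (q ^ (d * e)), qPochhammer_succ (-t * (q⁻¹ * q ^ (d * e))),
    qPochhammer_succ' (-t * q⁻¹), mul_assoc (-t) q⁻¹] at h
  refine mul_left_cancel₀ h4 ?_
  rw [pow_succ' (q ^ (d * e))] at h ⊢
  linear_combination h

/-- As for $r=0$, the common factor is $(-tq^{-1}Q;Q)_{n-r-1}$, but the cofactor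
$(1-x)(1+tq^{-1}Q^{n-r})+(x-Q^n)(1+tq^{-1})$ is left unfactored: it is the last bracket of the
formula. -/
theorem closedForm_mid_of_two_le {d e : ℕ} (hq : q ≠ 0) (hq1 : ∀ k, 1 ≤ k → q ^ k ≠ 1)
    (hd : 1 ≤ d) (he : 1 ≤ e) (hn : r + 1 ≤ n)
    (h : (qPochhammer (q ^ (d * e)) (q ^ (d * e)) (n - r) *
        qPochhammer (q ^ (d * e)) (q ^ (d * e)) r) * ((1 - q ^ (d * n)) * H)
      = fermionProduct q t (q ^ (d * e)) r *
        ((1 - q ^ (d * n)) * qPochhammer (-t * q ^ (d * e - 1)) (q ^ (d * e)) (n - r) +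
          (q ^ (d * n) - (q ^ (d * e)) ^ n) * qPochhammer (-t * q⁻¹) (q ^ (d * e)) (n - r))) :
    H = q ^ (d * e * r.choose 2 + r)
      * ((qPochhammer (-t * q⁻¹) ((q ^ (d * e))⁻¹) r
          * qPochhammer (-t * q ^ (d * e - 1)) (q ^ (d * e)) (n - 1 - r))
        / (qPochhammer (q ^ (d * e)) (q ^ (d * e)) r
          * qPochhammer (q ^ (d * e)) (q ^ (d * e)) (n - r) * (1 - q ^ (d * n))))
      * (1 - q ^ (d * e * n) + t * q⁻¹ * (q ^ (d * e * (n - r)) * (1 - q ^ (d * n))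
          + q ^ (d * n) - q ^ (d * e * n))) := by
  have hN : 1 ≤ d * e := Nat.mul_pos hd he
  have hQ : ∀ k, 1 ≤ k → (q ^ (d * e)) ^ k ≠ 1 := fun k hk => by
    rw [← pow_mul]
    exact hq1 _ (Nat.mul_pos hN hk)
  have h1 : q ^ (d * e - 1) = q⁻¹ * q ^ (d * e) := by
    rw [pow_sub₀ q hq hN, pow_one, mul_comm]
  have hP := qPochhammer_self_ne_zero hQ r
  have hP' := qPochhammer_self_ne_zero hQ (n - r)
  have h3 := sub_ne_zero.2 (hq1 _ (Nat.mul_pos hd (by omega : 0 < n))).symm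
  obtain ⟨m, hm⟩ : ∃ m, n - r = m + 1 := ⟨n - r - 1, by omega⟩
  have hm' : n - 1 - r = m := by omega
  rw [fermionProduct_eq hq (pow_ne_zero _ hq)] at h
  rw [mul_div_assoc', div_mul_eq_mul_div, eq_div_iff (mul_ne_zero (mul_ne_zero hP hP') h3),
    pow_add, pow_mul q (d * e) (r.choose 2), pow_mul q (d * e) n, pow_mul q (d * e) (n - r)]
  rw [hm']
  rw [hm, h1] at h
  rw [hm, h1]
  rw [qPochhammer_succ (-t * (q⁻¹ * q ^ (d * e))),
    qPochhammer_succ' (-t * q⁻¹), mul_assoc (-t) q⁻¹] at h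
  rw [pow_succ' (q ^ (d * e)) m]
  linear_combination h

/-- Both fermion products share $r-1$ factors, and both boson products share $n-1-r$. What is left
over from the three terms makes up the three summands of the bracket. -/
theorem closedForm_mid_of_one {e : ℕ} (hq : q ≠ 0) (hq1 : ∀ k, 1 ≤ k → q ^ k ≠ 1)
    (he : 2 ≤ e) (hr : 1 ≤ r) (hn : r + 1 ≤ n)
    (h : (qPochhammer (q ^ e) (q ^ e) (n - r) * qPochhammer (q ^ e) (q ^ e) r) *
        ((1 - q ^ n) * H)
      = fermionProduct q t (q ^ e) r *
        ((1 - q ^ n) * qPochhammer (-t * q ^ (e - 1)) (q ^ e) (n - r) +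
          (q ^ n - q ^ (n * (e - 1))) * qPochhammer (-t * q⁻¹) (q ^ e) (n - r)) +
        (1 - q ^ n) * q ^ (n * (e - 1)) * (qPochhammer (-t * q⁻¹) (q ^ e) (n - r) *
          fermionProduct (q / q ^ e) t (q ^ e) r)) :
    H = q ^ (e * r.choose 2)
      * ((qPochhammer (-t * q⁻¹) ((q ^ e)⁻¹) (r - 1)
          * qPochhammer (-t * q ^ (e - 1)) (q ^ e) (n - 1 - r))
        / (qPochhammer (q ^ e) (q ^ e) r * qPochhammer (q ^ e) (q ^ e) (n - r) * (1 - q ^ n)))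
      * (q ^ r * (1 + t * q ^ (((n : ℤ) - r) * e - 1))
            * (1 + t * q ^ (-((r : ℤ) - 1) * e - 1)) * (1 - q ^ n)
          + q ^ (((n : ℤ) - r) * ((e : ℤ) - 1) - 1) * (1 + t * q ^ (e - 1))
            * (1 - q ^ n) * (q + t)
          + q ^ (r - 1) * (1 + t * q ^ (-((r : ℤ) - 1) * e - 1))
            * (q + t) * (q ^ n - q ^ (n * (e - 1)))) := by
  have hQ : ∀ k, 1 ≤ k → (q ^ e) ^ k ≠ 1 := fun k hk => by
    rw [← pow_mul]
    exact hq1 _ (Nat.mul_pos (by omega) hk)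
  obtain ⟨f, rfl⟩ := Nat.exists_eq_add_of_le' (by omega : 1 ≤ e)
  obtain ⟨s, rfl⟩ := Nat.exists_eq_add_of_le' hr
  obtain ⟨m, rfl⟩ : ∃ m, n = s + 1 + (m + 1) := ⟨n - s - 1 - 1, by omega⟩
  have hP := qPochhammer_self_ne_zero hQ (s + 1)
  have hP' := qPochhammer_self_ne_zero hQ (m + 1)
  have h3 := sub_ne_zero.2 (hq1 (s + 1 + (m + 1)) (by omega)).symm
  have e1 : s + 1 + (m + 1) - (s + 1) = m + 1 := by omega
  have e2 : s + 1 + (m + 1) - 1 - (s + 1) = m := by omega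
  have z1 : q ^ (((s + 1 + (m + 1) : ℕ) : ℤ) - ((s + 1 : ℕ) : ℤ)) = q ^ (m + 1) := by
    rw [← zpow_natCast]; congr 1; push_cast; ring
  have z2 : q ^ ((((s + 1 + (m + 1) : ℕ) : ℤ) - ((s + 1 : ℕ) : ℤ)) * ((f + 1 : ℕ) : ℤ) - 1)
      = (q ^ (f + 1)) ^ (m + 1) * q⁻¹ := by
    rw [zpow_sub_one₀ hq, zpow_mul, z1, zpow_natCast, ← pow_mul, ← pow_mul, mul_comm (m + 1)]
  have z3 : q ^ (-(((s + 1 : ℕ) : ℤ) - 1) * ((f + 1 : ℕ) : ℤ) - 1)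
      = ((q ^ (f + 1)) ^ s)⁻¹ * q⁻¹ := by
    have : -(((s + 1 : ℕ) : ℤ) - 1) * ((f + 1 : ℕ) : ℤ) = -(((f + 1) * s : ℕ) : ℤ) := by
      push_cast; ring
    rw [zpow_sub_one₀ hq, this, zpow_neg, zpow_natCast, pow_mul]
  have z4 : q ^ ((((s + 1 + (m + 1) : ℕ) : ℤ) - ((s + 1 : ℕ) : ℤ)) * (((f + 1 : ℕ) : ℤ) - 1) - 1)
      = (q ^ f) ^ (m + 1) * q⁻¹ := by
    have : (((s + 1 + (m + 1) : ℕ) : ℤ) - ((s + 1 : ℕ) : ℤ)) * (((f + 1 : ℕ) : ℤ) - 1)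
      = ((f * (m + 1) : ℕ) : ℤ) := by
      push_cast; ring
    rw [zpow_sub_one₀ hq, this, zpow_natCast, pow_mul]
  have hc : (s + 1).choose 2 = s.choose 2 + s := by
    rw [Nat.choose_succ_succ, Nat.choose_one_right, add_comm]
  have z5 : q ^ ((f + 1) * (s + 1).choose 2) = (q ^ (f + 1)) ^ s.choose 2 * (q ^ (f + 1)) ^ s := by
    rw [pow_mul, hc, pow_add]
  have z6 : q ^ ((s + 1 + (m + 1)) * f) = (q ^ f) ^ s * q ^ f * (q ^ f) ^ (m + 1) := by
    ring
  have z7 : -t * q ^ f = -t * q⁻¹ * q ^ (f + 1) := by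
    rw [pow_succ]; field_simp
  rw [mul_div_assoc', div_mul_eq_mul_div, z2, z3, z4, z5]
  rw [fermionProduct_succ, fermionProduct_div_succ _ _ (pow_ne_zero _ hq),
    fermionProduct_eq hq (pow_ne_zero _ hq)] at h
  simp only [e1, e2, Nat.add_sub_cancel, z6] at h ⊢
  rw [eq_div_iff (mul_ne_zero (mul_ne_zero hP hP') h3)]
  rw [qPochhammer_succ (-t * q ^ f), qPochhammer_succ' (-t * q⁻¹), ← z7] at h
  have hx : (q ^ (f + 1)) ^ s ≠ 0 := pow_ne_zero _ (pow_ne_zero _ hq)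
  -- With the shared products and the power `q ^ f` as indeterminates, the claim becomes a rational
  -- identity.
  generalize qPochhammer (q ^ (f + 1)) (q ^ (f + 1)) (m + 1) = P₁ at *
  generalize qPochhammer (q ^ (f + 1)) (q ^ (f + 1)) (s + 1) = P₂ at *
  generalize qPochhammer (-t * q ^ f) (q ^ (f + 1)) m = A at *
  generalize qPochhammer (-t * q⁻¹) (q ^ (f + 1))⁻¹ s = B at *
  have h' : H * (P₂ * P₁ * (1 - q ^ (s + 1 + (m + 1)))) = _ :=
    (by ring : _ = P₁ * P₂ * ((1 - q ^ (s + 1 + (m + 1))) * H)).trans h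
  rw [h']
  have ha : q ^ f ≠ 0 := pow_ne_zero _ hq
  rw [pow_succ q f]
  generalize q ^ f = a at *
  generalize s.choose 2 = c
  field_simp
  ring

theorem closedForm_top {d e : ℕ} (hq : q ≠ 0) (hq1 : ∀ k, 1 ≤ k → q ^ k ≠ 1)
    (hd : 1 ≤ d) (he : 1 ≤ e) (hn : 1 ≤ n) {T : K}
    (h : qPochhammer (q ^ (d * e)) (q ^ (d * e)) n * ((1 - q ^ (d * n)) * H)
      = fermionProduct q t (q ^ (d * e)) (n - 1) * ((1 - (q ^ (d * e)) ^ n) * T)) :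
    H = q ^ (d * e * (n - 1).choose 2 + (n - 1))
        * (qPochhammer (-t * q⁻¹) ((q ^ (d * e))⁻¹) (n - 1)
          / (qPochhammer (q ^ (d * e)) (q ^ (d * e)) (n - 1) * (1 - q ^ (d * n)))) * T := by
  have hN : 1 ≤ d * e := Nat.mul_pos hd he
  have hQ : ∀ k, 1 ≤ k → (q ^ (d * e)) ^ k ≠ 1 := fun k hk => by
    rw [← pow_mul]
    exact hq1 _ (Nat.mul_pos hN hk)
  obtain ⟨m, rfl⟩ := Nat.exists_eq_add_of_le' hn
  rw [Nat.add_sub_cancel] at h ⊢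
  have hP := qPochhammer_self_ne_zero hQ m
  have h3 := sub_ne_zero.2 (hq1 _ (Nat.mul_pos hd hn)).symm
  have h4 := sub_ne_zero.2 (hQ (m + 1) hn).symm
  rw [mul_div_assoc', div_mul_eq_mul_div, eq_div_iff (mul_ne_zero hP h3), pow_add,
    pow_mul q (d * e) (m.choose 2)]
  rw [qPochhammer_succ (q ^ (d * e)), fermionProduct_eq hq (pow_ne_zero _ hq)] at h
  refine mul_left_cancel₀ h4 ?_
  rw [pow_succ' (q ^ (d * e))] at h ⊢
  linear_combination h

end ClosedForms

end

/-! ### Assembly of the formulas -/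

theorem Hilb_identity_of_two_le {d e n r : ℕ} (hd : 2 ≤ d) (he : 1 ≤ e) (hn : 1 ≤ n)
    (hr : r ≤ n) :
    (qPochhammer (qVar ^ (d * e)) (qVar ^ (d * e)) (n - r) *
        qPochhammer (qVar ^ (d * e)) (qVar ^ (d * e)) r) * ((1 - qVar ^ (d * n)) *
      Hilb (shephardTodd d e n) (wedgeRep (shephardTodd d e n) r))
      = fermionProduct qVar tVar (qVar ^ (d * e)) r *
        ((1 - qVar ^ (d * n)) *
            qPochhammer (-tVar * qVar ^ (d * e - 1)) (qVar ^ (d * e)) (n - r) +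
          (qVar ^ (d * n) - (qVar ^ (d * e)) ^ n) *
            qPochhammer (-tVar * qVar⁻¹) (qVar ^ (d * e)) (n - r)) := by
  have h1 := qPochhammer_mul_Hilb_wedgeRep (by omega : 1 ≤ d) he hn hr
  have h2 := sum_chargeTerm_of_two_le qVar_ne_zero tVar hd he (n - r) r
  rw [← h1, Nat.sub_add_cancel hr] at h2
  rw [← h2]
  ring

theorem Hilb_identity_of_one {e n r : ℕ} (he : 2 ≤ e) (hn : 1 ≤ n) (hr : r ≤ n) :
    (qPochhammer (qVar ^ e) (qVar ^ e) (n - r) * qPochhammer (qVar ^ e) (qVar ^ e) r) *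
      ((1 - qVar ^ n) * Hilb (shephardTodd 1 e n) (wedgeRep (shephardTodd 1 e n) r))
      = fermionProduct qVar tVar (qVar ^ e) r *
        ((1 - qVar ^ n) * qPochhammer (-tVar * qVar ^ (e - 1)) (qVar ^ e) (n - r) +
          (qVar ^ n - qVar ^ (n * (e - 1))) *
            qPochhammer (-tVar * qVar⁻¹) (qVar ^ e) (n - r)) +
        (1 - qVar ^ n) * qVar ^ (n * (e - 1)) *
          (qPochhammer (-tVar * qVar⁻¹) (qVar ^ e) (n - r) *
            fermionProduct (qVar / qVar ^ e) tVar (qVar ^ e) r) := by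
  have h1 := qPochhammer_mul_Hilb_wedgeRep le_rfl (by omega : 1 ≤ e) hn hr
  have h2 := sum_chargeTerm_of_one qVar_ne_zero tVar he (n - r) r
  simp only [one_mul] at h1
  rw [← h1, Nat.sub_add_cancel hr] at h2
  rw [← h2]
  ring

end

end MonomialGroups

theorem corollary3p8 (d e n : ℕ) (hd : 1 ≤ d) (he : 1 ≤ e) (hn : 2 ≤ n) (hde : 2 ≤ d * e)
    (W : Subgroup (GL (Fin n) ℂ)) (hW : W = MonomialGroups.shephardTodd d e n)
    (q t : MonomialGroups.SeriesField)
    (hq : q = MonomialGroups.qVar) (ht : t = MonomialGroups.tVar) :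
    (∀ r : ℕ, r ≤ n →
      MonomialGroups.Hilb W (MonomialGroups.wedgeRep W r)
        = MonomialGroups.isotypicSeries W (MonomialGroups.wedgeRep W r).dual) ∧
    MonomialGroups.Hilb W (MonomialGroups.wedgeRep W 0)
      = (MonomialGroups.qPochhammer (-t * q ^ (d * e - 1)) (q ^ (d * e)) (n - 1)
          * (1 + t * q ^ (d * n - 1)))
        / (MonomialGroups.qPochhammer (q ^ (d * e)) (q ^ (d * e)) (n - 1)
          * (1 - q ^ (d * n))) ∧
    (∀ r : ℕ, 1 ≤ r → r ≤ n - 1 → 2 ≤ d →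
      MonomialGroups.Hilb W (MonomialGroups.wedgeRep W r)
        = q ^ (d * e * r.choose 2 + r)
          * ((MonomialGroups.qPochhammer (-t * q⁻¹) ((q ^ (d * e))⁻¹) r
              * MonomialGroups.qPochhammer (-t * q ^ (d * e - 1)) (q ^ (d * e)) (n - 1 - r))
            / (MonomialGroups.qPochhammer (q ^ (d * e)) (q ^ (d * e)) r
              * MonomialGroups.qPochhammer (q ^ (d * e)) (q ^ (d * e)) (n - r)
              * (1 - q ^ (d * n))))
          * (1 - q ^ (d * e * n)
              + t * q⁻¹ * (q ^ (d * e * (n - r)) * (1 - q ^ (d * n))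
                  + q ^ (d * n) - q ^ (d * e * n)))) ∧
    (∀ r : ℕ, 1 ≤ r → r ≤ n - 1 → d = 1 →
      MonomialGroups.Hilb W (MonomialGroups.wedgeRep W r)
        = q ^ (e * r.choose 2)
          * ((MonomialGroups.qPochhammer (-t * q⁻¹) ((q ^ e)⁻¹) (r - 1)
              * MonomialGroups.qPochhammer (-t * q ^ (e - 1)) (q ^ e) (n - 1 - r))
            / (MonomialGroups.qPochhammer (q ^ e) (q ^ e) r
              * MonomialGroups.qPochhammer (q ^ e) (q ^ e) (n - r)
              * (1 - q ^ n)))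
          * (q ^ r * (1 + t * q ^ (((n : ℤ) - r) * e - 1))
                * (1 + t * q ^ (-((r : ℤ) - 1) * e - 1)) * (1 - q ^ n)
              + q ^ (((n : ℤ) - r) * ((e : ℤ) - 1) - 1) * (1 + t * q ^ (e - 1))
                * (1 - q ^ n) * (q + t)
              + q ^ (r - 1) * (1 + t * q ^ (-((r : ℤ) - 1) * e - 1))
                * (q + t) * (q ^ n - q ^ (n * (e - 1))))) ∧
    MonomialGroups.Hilb W (MonomialGroups.wedgeRep W n)
      = q ^ (d * e * (n - 1).choose 2 + (n - 1))
        * (MonomialGroups.qPochhammer (-t * q⁻¹) ((q ^ (d * e))⁻¹) (n - 1)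
          / (MonomialGroups.qPochhammer (q ^ (d * e)) (q ^ (d * e)) (n - 1)
            * (1 - q ^ (d * n))))
        * (if 2 ≤ d then q ^ (d * e * (n - 1) + 1) + t else q ^ ((n - 1) * (e - 1)) + t) := by
  open MonomialGroups in
  subst hW hq ht
  have hq0 := qVar_ne_zero
  have hq1 : ∀ k, 1 ≤ k → qVar ^ k ≠ 1 := fun k hk => qVar_pow_ne_one hk
  have hn1 : 1 ≤ n := by omega
  -- The bound $de\ge2$ excludes $N=1$, where both wrap-arounds would occur at the same charge.
  have hcases : 2 ≤ d ∨ (d = 1 ∧ 2 ≤ e) := by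
    rcases Nat.lt_or_ge 1 d with h | h
    · exact Or.inl h
    · obtain rfl : d = 1 := by omega
      exact Or.inr ⟨rfl, by omega⟩
  refine ⟨fun r _ => Hilb_eq_isotypicSeries_dual _ _, ?_, ?_, ?_, ?_⟩
  · refine closedForm_zero hq0 hq1 hd he hn1 ?_
    rcases hcases with h | ⟨rfl, h⟩
    · have h1 := Hilb_identity_of_two_le h he hn1 (Nat.zero_le n)
      simpa only [fermionProduct, qPochhammer, Finset.prod_range_zero, Nat.sub_zero, one_mul,
        mul_one] using h1
    · have h1 := Hilb_identity_of_one h hn1 (Nat.zero_le n)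
      -- For $r=0$ the fermion product is empty, so the exceptional top charge rejoins the geometric
      -- series and $d=1$ obeys the same identity as $d\ge2$.
      have h2 : (qVar ^ e) ^ n = qVar ^ n * qVar ^ (n * (e - 1)) := by
        rw [← pow_mul, ← pow_add]
        congr 1
        obtain ⟨f, rfl⟩ := Nat.exists_eq_add_of_le' he
        rw [Nat.add_sub_cancel]
        ring
      simp only [fermionProduct, Finset.prod_range_zero, Nat.sub_zero, one_mul] at h1 ⊢
      rw [h2]
      simp only [qPochhammer, Finset.prod_range_zero, mul_one] at h1 ⊢
      linear_combination h1
  · intro r hr hrn hd2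
    exact closedForm_mid_of_two_le hq0 hq1 hd he (by omega)
      (Hilb_identity_of_two_le hd2 he hn1 (by omega))
  · rintro r hr hrn rfl
    have h : 2 ≤ e := by omega
    exact closedForm_mid_of_one hq0 hq1 h hr (by omega) (Hilb_identity_of_one h hn1 (by omega))
  · refine closedForm_top hq0 hq1 hd he hn1 ?_
    -- For $r=n$ the boson product is empty. The factor $T$ is the last fermion factor $t+qQ^{n-1}$
    -- if $d\ge2$; if $d=1$ it arises by combining that factor with the wrapped one $t+q/Q$.
    obtain ⟨m, rfl⟩ := Nat.exists_eq_add_of_le' hn1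
    rw [Nat.add_sub_cancel]
    rcases hcases with h | ⟨rfl, h⟩
    · have h1 := Hilb_identity_of_two_le h he hn1 le_rfl
      rw [Nat.sub_self, fermionProduct_succ] at h1
      simp only [qPochhammer, Finset.prod_range_zero, mul_one, one_mul] at h1 ⊢
      rw [if_pos h, pow_succ qVar (d * e * m), pow_mul qVar (d * e) m, h1]
      ring
    · have h1 := Hilb_identity_of_one h hn1 (le_refl (m + 1))
      rw [Nat.sub_self, fermionProduct_succ, fermionProduct_div_succ _ _ (pow_ne_zero _ hq0)] at h1
      simp only [qPochhammer, Finset.prod_range_zero, mul_one, one_mul] at h1 ⊢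
      rw [if_neg (by omega), h1]
      obtain ⟨f, rfl⟩ := Nat.exists_eq_add_of_le' he
      rw [Nat.add_sub_cancel]
      have hf : qVar / qVar ^ (f + 1) = (qVar ^ f)⁻¹ := by
        rw [pow_succ]
        field_simp
      have hf0 : qVar ^ f ≠ 0 := pow_ne_zero _ hq0
      have hf1 : qVar ^ ((m + 1) * f) = qVar ^ (m * f) * qVar ^ f := by ring
      rw [hf, hf1]
      field_simp
      ring
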